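/- Let $K$ be a field. Let $\mathbf{DGVct}$ be the monoidal category of non-negatively graded chain complexes of $K$-vector spaces (differential of degree $-1$), with $(X\otimes Y)_n=\bigoplus_{p+q=n}X_p\otimes_K Y_q$, $d(x\otimes y)=dx\otimes y+(-1)^{|x|}x\otimes dy$, and unit $K[0]$ ($K$ in degree $0$). Let $\mathbf{DGcoAlg}_c$ be the category of connected differential graded coalgebras over $K$: its objects are the comonoids $C$ (counital coassociative differential graded coalgebras, not necessarily cocommutative) in $\mathbf{DGVct}$ with $C_0=K$ (that is, $C_0$ is one-dimensional), and its morphisms are the morphisms of comonoids. A morphism $g$ of $\mathbf{DGcoAlg}_c$ is a weak equivalence if $H_*(g)$ is an isomorphism, a cofibration if it is injective in every degree, an acyclic cofibration if it is both a cofibration and a weak equivalence, and a fibration if it has the right lifting property in $\mathbf{DGcoAlg}_c$ with respect to all acyclic cofibrations. Then every morphism $f\colon C\to D$ in $\mathbf{DGcoAlg}_c$ can be factored as $$C\xrightarrow{\;i\;}G\xrightarrow{\;p\;}D,\qquad f=p\circ i,$$ with $G$ in $\mathbf{DGcoAlg}_c$, $i$ an acyclic cofibration and $p$ a fibration. -/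

import Mathlib

open CategoryTheory MonoidalCategory

universe u

/-- `DGVct`: non-negatively graded complexes of `K`-vector spaces with differential of degree `-1`.
Mathlib's monoidal structure on it is `(X ⊗ Y)_n = ⨁_{p + q = n} X_p ⊗_K Y_q` with
`d (x ⊗ y) = dx ⊗ y + (-1)^|x| x ⊗ dy`, and its unit is `K` concentrated in degree `0`. -/
abbrev DGVct (K : Type u) [Field K] := ChainComplex (ModuleCat.{u} K) ℕ

/-- `DGcoAlg`: counital coassociative differential graded `K`-coalgebras, that is, comonoids in the
monoidal category `DGVct`; its morphisms are the morphisms of comonoids. -/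
abbrev DGcoAlg (K : Type u) [Field K] := Comon (DGVct K)

/-- A differential graded coalgebra `C` is connected if `C_0 = K`, i.e. `C_0` is one-dimensional
(the counit is then automatically an isomorphism `C_0 ≅ K`). -/
def DGcoAlg.isConnected (K : Type u) [Field K] : ObjectProperty (DGcoAlg K) :=
  fun C => Nonempty (C.X.X 0 ≃ₗ[K] K)

/-- The category of connected differential graded coalgebras, a full subcategory of `DGcoAlg`. -/
abbrev DGcoAlgConn (K : Type u) [Field K] := (DGcoAlg.isConnected K).FullSubcategory

namespace DGcoAlgConn

variable (K : Type u) [Field K]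

/-- The underlying complex of a connected differential graded coalgebra. -/
noncomputable abbrev U : DGcoAlgConn K ⥤ DGVct K :=
  (DGcoAlg.isConnected K).ι ⋙ Comon.forget (DGVct K)

/-- Weak equivalences: the morphisms `f` such that `H_* f` is an isomorphism. -/
def weakEquivalences : MorphismProperty (DGcoAlgConn K) :=
  fun _ _ f => ∀ n : ℕ, IsIso (HomologicalComplex.homologyMap ((U K).map f) n)

/-- Cofibrations: the degreewise injective morphisms. -/
def cofibrations : MorphismProperty (DGcoAlgConn K) :=
  fun _ _ f => ∀ n : ℕ, Function.Injective (((U K).map f).f n)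

/-- Acyclic cofibrations: the cofibrations which are weak equivalences. -/
def acyclicCofibrations : MorphismProperty (DGcoAlgConn K) :=
  cofibrations K ⊓ weakEquivalences K

/-- Fibrations: the morphisms with the right lifting property, in the category of connected
differential graded coalgebras, with respect to the acyclic cofibrations. -/
def fibrations : MorphismProperty (DGcoAlgConn K) :=
  (acyclicCofibrations K).rlp

end DGcoAlgConn

/-! The factorization comes from the small object argument in the category of all differential
graded coalgebras, applied to `acyclicExtensions`. Between connected coalgebras these are exactly
the acyclic cofibrations (`acyclicCofibrations_iff`). Bijectivity in degree 0 makes the middle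
object connected, so no construction takes place inside the connected subcategory.

Generation: given an acyclic extension `A ⟶ B`, every element of `B` lies in a subcoalgebra `E` of
countable dimension with `A ∩ E ⟶ E` again an acyclic extension (`exists_countable_subextension`).
If `p` lifts against the countable extensions, take by Zorn a maximal partial lift, with domain `G ⊆
B` and `B/G` acyclic. Lifting over `G ∩ E ⟶ E` extends it to `G + E`, and `B/(G + E)` stays acyclic
because `(G + E)/G = E/(G ∩ E)`. So `G = B`, and `p` lifts against all acyclic extensions
(`rlp_countableAcyclicExtensions_le`). Countable coalgebras form a set up to isomorphism, which
gives a generating set (`exists_isSmall_rlp_le`).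

Stability: colimits of coalgebras are computed on complexes, and being an acyclic extension is a
conjunction of left lifting properties there (`acyclicExtensions_iff`). Hence relative cell
complexes of acyclic extensions are acyclic extensions.

Smallness: a map from a countable coalgebra to an `ℵ₁`-filtered colimit of subcoalgebras already
lands in one of them. -/

open Limits ComonObj

/-! ### Tensor products of complexes on homogeneous elements -/

namespace DGVct

variable {K : Type u} [Field K]

/-- The homogeneous element `x ⊗ y` of the tensor product of two complexes. -/
noncomputable def tmul {X Y : DGVct K} {p q n : ℕ} (h : p + q = n) (x : X.X p) (y : Y.X q) :
    (X ⊗ Y).X n :=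
  (HomologicalComplex.ιTensorObj X Y p q n h).hom (x ⊗ₜ[K] y)

section

variable {X Y X' Y' : DGVct K}

lemma tensor_ι_map (f : X ⟶ X') (g : Y ⟶ Y') {p q n : ℕ} (h : p + q = n) :
    HomologicalComplex.ιTensorObj X Y p q n h ≫ (f ⊗ₘ g).f n =
      (f.f p ⊗ₘ g.f q) ≫ HomologicalComplex.ιTensorObj X' Y' p q n h := by
  have := HomologicalComplex.ι_mapBifunctorMap f g (curriedTensor _) (ComplexShape.down ℕ) p q n h
  refine this.trans ?_
  rw [MonoidalCategory.tensorHom_def]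
  exact (Category.assoc _ _ _).symm

@[simp]
lemma map_tmul (f : X ⟶ X') (g : Y ⟶ Y') {p q n : ℕ} (h : p + q = n) (x : X.X p) (y : Y.X q) :
    ((f ⊗ₘ g).f n).hom (tmul h x y) = tmul h ((f.f p).hom x) ((g.f q).hom y) :=
  congr($(tensor_ι_map f g h).hom (x ⊗ₜ[K] y))

lemma tensor_hom_ext {n : ℕ} {Z : ModuleCat.{u} K} {a b : (X ⊗ Y).X n ⟶ Z}
    (H : ∀ p q h, HomologicalComplex.ιTensorObj X Y p q n h ≫ a =
      HomologicalComplex.ιTensorObj X Y p q n h ≫ b) : a = b :=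
  HomologicalComplex.mapBifunctor.hom_ext H

lemma tensor_linearMap_ext {n : ℕ} {Z : ModuleCat.{u} K} {a b : (X ⊗ Y).X n ⟶ Z}
    (H : ∀ p q (h : p + q = n) (x : X.X p) (y : Y.X q), a.hom (tmul h x y) = b.hom (tmul h x y)) :
    a = b := by
  refine tensor_hom_ext fun p q h => ModuleCat.hom_ext (TensorProduct.ext' fun x y => ?_)
  exact H p q h x y

/-- The quotient map by `S` kills every homogeneous tensor, hence is zero. -/
lemma tmul_induction {n : ℕ} {S : Submodule K ((X ⊗ Y).X n)}
    (H : ∀ p q (h : p + q = n) (x : X.X p) (y : Y.X q), tmul h x y ∈ S) : S = ⊤ := by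
  have h : ModuleCat.ofHom S.mkQ = (0 : (X ⊗ Y).X n ⟶ ModuleCat.of K (_ ⧸ S)) := by
    refine tensor_linearMap_ext fun p q h x y => ?_
    simpa using H p q h x y
  have h2 : S.mkQ = 0 := congr($(h).hom)
  rw [← S.ker_mkQ, h2, LinearMap.ker_zero]

/-- Over a field both maps have linear retractions in each degree. These need not commute with the
differentials, but their tensor product still retracts degree `n`. -/
lemma tensorHom_injective (f : X ⟶ X') (g : Y ⟶ Y') (hf : ∀ n, Function.Injective (f.f n))
    (hg : ∀ n, Function.Injective (g.f n)) (n : ℕ) : Function.Injective ((f ⊗ₘ g).f n) := by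
  have hf' (n) : ∃ r : X'.X n ⟶ X.X n, f.f n ≫ r = 𝟙 _ := by
    obtain ⟨r, hr⟩ := (f.f n).hom.exists_leftInverse_of_injective
      (LinearMap.ker_eq_bot.2 (hf n))
    exact ⟨ModuleCat.ofHom r, ModuleCat.hom_ext hr⟩
  have hg' (n) : ∃ r : Y'.X n ⟶ Y.X n, g.f n ≫ r = 𝟙 _ := by
    obtain ⟨r, hr⟩ := (g.f n).hom.exists_leftInverse_of_injective
      (LinearMap.ker_eq_bot.2 (hg n))
    exact ⟨ModuleCat.ofHom r, ModuleCat.hom_ext hr⟩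
  choose r hr using hf'
  choose s hs using hg'
  let R : (X' ⊗ Y').X n ⟶ (X ⊗ Y).X n := HomologicalComplex.mapBifunctorDesc
    (K₁ := X') (K₂ := Y') (F := curriedTensor _) (c := ComplexShape.down ℕ)
    (fun p q h => (r p ⊗ₘ s q) ≫ HomologicalComplex.ιTensorObj X Y p q n h)
  have hR : (f ⊗ₘ g).f n ≫ R = 𝟙 _ := by
    refine tensor_hom_ext fun p q h => ?_
    rw [← Category.assoc, tensor_ι_map, Category.assoc]
    have : HomologicalComplex.ιTensorObj X' Y' p q n h ≫ R =
        (r p ⊗ₘ s q) ≫ HomologicalComplex.ιTensorObj X Y p q n h :=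
      HomologicalComplex.ι_mapBifunctorDesc _ _ _ _
    rw [this, ← Category.assoc, MonoidalCategory.tensorHom_comp_tensorHom, hr, hs,
      MonoidalCategory.id_tensorHom_id, Category.id_comp]
    exact (Category.comp_id _).symm
  exact Function.LeftInverse.injective (g := R) fun x => congr($(hR).hom x)

end

/-- The graded subspace `S ⊗ S` of `X ⊗ X`. -/
noncomputable def sq {X : DGVct K} (S : ∀ n, Submodule K (X.X n)) (n : ℕ) :
    Submodule K ((X ⊗ X).X n) :=
  Submodule.span K {z | ∃ (p q : ℕ) (h : p + q = n), ∃ x ∈ S p, ∃ y ∈ S q, z = tmul h x y}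

lemma tmul_mem_sq {X : DGVct K} {S : ∀ n, Submodule K (X.X n)} {p q n : ℕ} (h : p + q = n)
    {x : X.X p} {y : X.X q} (hx : x ∈ S p) (hy : y ∈ S q) : tmul h x y ∈ sq S n :=
  Submodule.subset_span ⟨p, q, h, x, hx, y, hy, rfl⟩

lemma sq_mono {X : DGVct K} {S T : ∀ n, Submodule K (X.X n)} (h : ∀ n, S n ≤ T n) (n : ℕ) :
    sq S n ≤ sq T n := by
  refine Submodule.span_le.2 ?_
  rintro _ ⟨p, q, hpq, x, hx, y, hy, rfl⟩
  exact tmul_mem_sq hpq (h _ hx) (h _ hy)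

lemma range_tensorHom {X Y : DGVct K} (s : X ⟶ Y) (n : ℕ) :
    LinearMap.range ((s ⊗ₘ s).f n).hom = sq (fun m => LinearMap.range (s.f m).hom) n := by
  apply le_antisymm
  · rw [LinearMap.range_eq_map, Submodule.map_le_iff_le_comap, top_le_iff]
    refine tmul_induction fun p q h x y => ?_
    rw [Submodule.mem_comap, map_tmul]
    exact tmul_mem_sq h ⟨x, rfl⟩ ⟨y, rfl⟩
  · refine Submodule.span_le.2 ?_
    rintro _ ⟨p, q, hpq, _, ⟨x, rfl⟩, _, ⟨y, rfl⟩, rfl⟩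
    exact ⟨tmul hpq x y, map_tmul _ _ _ _ _⟩

lemma sq_top {X : DGVct K} (n : ℕ) : sq (X := X) (fun _ => ⊤) n = ⊤ :=
  tmul_induction fun _ _ h _ _ => tmul_mem_sq h trivial trivial

lemma injective_of_mono {X Y : DGVct K} (f : X ⟶ Y) [Mono f] (n : ℕ) :
    Function.Injective (f.f n) :=
  (ModuleCat.mono_iff_injective _).1 inferInstance

lemma mono_of_injective {X Y : DGVct K} (f : X ⟶ Y) (hf : ∀ n, Function.Injective (f.f n)) :
    Mono f :=
  haveI := fun n => (ModuleCat.mono_iff_injective (f.f n)).2 (hf n)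
  HomologicalComplex.mono_of_mono_f f inferInstance

instance {X Y X' Y' : DGVct K} (f : X ⟶ X') (g : Y ⟶ Y') [Mono f] [Mono g] : Mono (f ⊗ₘ g) :=
  mono_of_injective _ (tensorHom_injective f g (injective_of_mono f) (injective_of_mono g))

/-- A morphism of complexes lifts through a monomorphism if it does so elementwise. -/
lemma exists_lift {X Y Z : DGVct K} (s : Y ⟶ Z) [Mono s] (g : X ⟶ Z)
    (h : ∀ n x, (g.f n).hom x ∈ LinearMap.range (s.f n).hom) : ∃ l : X ⟶ Y, l ≫ s = g := by
  have H (n) : ∃ l : X.X n ⟶ Y.X n, l ≫ s.f n = g.f n := by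
    refine ⟨ModuleCat.ofHom ((LinearEquiv.ofInjective (s.f n).hom
      (injective_of_mono s n)).symm.toLinearMap ∘ₗ
        (g.f n).hom.codRestrict (LinearMap.range (s.f n).hom) (h n)), ?_⟩
    ext x
    exact congr($(((LinearEquiv.ofInjective (s.f n).hom
      (injective_of_mono s n)).apply_symm_apply ⟨_, h n x⟩)).1)
  choose l hl using H
  refine ⟨⟨l, fun i j hij => ?_⟩, ?_⟩
  · rw [← cancel_mono (s.f j)]
    rw [Category.assoc, ← s.comm, ← Category.assoc, hl, g.comm, Category.assoc, hl]
  · ext n : 1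
    exact hl n

end DGVct

/-! ### Subcoalgebras -/

/-- A monomorphism `s : P ⟶ B` to a comonoid such that `s ≫ Δ` factors through `s ⊗ s` carries a
unique comonoid structure such that `s` is a morphism. -/
noncomputable abbrev CategoryTheory.ComonObj.ofMono {C : Type*} [Category* C] [MonoidalCategory C]
    {P B : C} [ComonObj B] (s : P ⟶ B) [Mono s] [Mono (s ⊗ₘ s)] [Mono (s ⊗ₘ (s ⊗ₘ s))]
    (δ : P ⟶ P ⊗ P) (hδ : δ ≫ (s ⊗ₘ s) = s ≫ Δ) : ComonObj P where
  counit := s ≫ ε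
  comul := δ
  -- Each axiom is tested after a monomorphism built from `s`, where it becomes the axiom for `B`.
  counit_comul := by
    have : Mono (𝟙 (𝟙_ C) ⊗ₘ s) := by
      rw [MonoidalCategory.id_tensorHom]
      have : 𝟙_ C ◁ s = (λ_ P).hom ≫ s ≫ (λ_ B).inv := by simp
      rw [this]
      infer_instance
    rw [← cancel_mono (𝟙 (𝟙_ C) ⊗ₘ s), ← MonoidalCategory.tensorHom_id, Category.assoc,
      MonoidalCategory.tensorHom_comp_tensorHom]
    have : (s ≫ ε) ≫ 𝟙 (𝟙_ C) ⊗ₘ 𝟙 P ≫ s = (s ⊗ₘ s) ≫ (ε ▷ B) := by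
      rw [← MonoidalCategory.tensorHom_id, MonoidalCategory.tensorHom_comp_tensorHom]
      simp
    rw [this, reassoc_of% hδ, counit_comul]
    simp
  comul_counit := by
    have : Mono (s ⊗ₘ 𝟙 (𝟙_ C)) := by
      rw [MonoidalCategory.tensorHom_id]
      have : s ▷ 𝟙_ C = (ρ_ P).hom ≫ s ≫ (ρ_ B).inv := by simp
      rw [this]
      infer_instance
    rw [← cancel_mono (s ⊗ₘ 𝟙 (𝟙_ C)), ← MonoidalCategory.id_tensorHom, Category.assoc,
      MonoidalCategory.tensorHom_comp_tensorHom]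
    have : 𝟙 P ≫ s ⊗ₘ (s ≫ ε) ≫ 𝟙 (𝟙_ C) = (s ⊗ₘ s) ≫ (B ◁ ε) := by
      rw [← MonoidalCategory.id_tensorHom, MonoidalCategory.tensorHom_comp_tensorHom]
      simp
    rw [this, reassoc_of% hδ, comul_counit]
    simp
  comul_assoc := by
    rw [← cancel_mono (s ⊗ₘ (s ⊗ₘ s))]
    have h1 : (P ◁ δ) ≫ (s ⊗ₘ (s ⊗ₘ s)) = (s ⊗ₘ s) ≫ (B ◁ Δ) := by
      rw [← MonoidalCategory.id_tensorHom, ← MonoidalCategory.id_tensorHom,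
        MonoidalCategory.tensorHom_comp_tensorHom, MonoidalCategory.tensorHom_comp_tensorHom, hδ]
      simp
    have h2 : (δ ▷ P) ≫ ((s ⊗ₘ s) ⊗ₘ s) = (s ⊗ₘ s) ≫ (Δ ▷ B) := by
      rw [← MonoidalCategory.tensorHom_id, ← MonoidalCategory.tensorHom_id,
        MonoidalCategory.tensorHom_comp_tensorHom, MonoidalCategory.tensorHom_comp_tensorHom, hδ]
      simp
    rw [Category.assoc, h1, reassoc_of% hδ, Category.assoc, Category.assoc,
      ← MonoidalCategory.associator_naturality, reassoc_of% h2, reassoc_of% hδ, comul_assoc]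

namespace DGcoAlg

open DGVct

variable {K : Type u} [Field K]

/-- The comultiplication on homogeneous elements. -/
noncomputable abbrev comulAt (B : DGcoAlg K) (n : ℕ) : B.X.X n →ₗ[K] (B.X ⊗ B.X).X n :=
  ((Δ[B.X] : B.X ⟶ B.X ⊗ B.X).f n).hom

/-- The components of a morphism of differential graded coalgebras. -/
noncomputable abbrev mapAt {B C : DGcoAlg K} (f : B ⟶ C) (n : ℕ) : B.X.X n →ₗ[K] C.X.X n :=
  (f.hom.f n).hom

lemma mapAt_comp {B C D : DGcoAlg K} (f : B ⟶ C) (g : C ⟶ D) (n : ℕ) (x : B.X.X n) :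
    mapAt (f ≫ g) n x = mapAt g n (mapAt f n x) := rfl

lemma mapAt_d {B C : DGcoAlg K} (f : B ⟶ C) (m n : ℕ) (x : B.X.X m) :
    mapAt f n ((B.X.d m n).hom x) = (C.X.d m n).hom (mapAt f m x) :=
  congr($(f.hom.comm m n).hom x).symm

lemma hom_ext_mapAt {B C : DGcoAlg K} {f g : B ⟶ C} (h : ∀ n x, mapAt f n x = mapAt g n x) :
    f = g := by
  ext n x
  exact h n x

lemma comulAt_mapAt {B C : DGcoAlg K} (f : B ⟶ C) (n : ℕ) (x : B.X.X n) :
    comulAt C n (mapAt f n x) = ((f.hom ⊗ₘ f.hom).f n).hom (comulAt B n x) := by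
  have : f.hom ≫ Δ = Δ ≫ (f.hom ⊗ₘ f.hom) := IsComonHom.hom_comul _
  exact congr(($(this).f n).hom x)

lemma comulAt_mapAt_mem {B C : DGcoAlg K} (f : B ⟶ C) (n : ℕ) (x : B.X.X n) :
    comulAt C n (mapAt f n x) ∈ sq (fun m => LinearMap.range (mapAt f m)) n := by
  rw [comulAt_mapAt, ← range_tensorHom]
  exact ⟨_, rfl⟩

/-- If a complex `P` embeds into a differential graded coalgebra `B` and maps to another one `X`
so that comultiplications of elements of `P` lift compatibly to `P ⊗ P`, then `P` is a differential
graded coalgebra, compatibly with both maps. -/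
lemma exists_of_lifts {B X : DGcoAlg K} {P : DGVct K} (π : P ⟶ B.X) (ξ : P ⟶ X.X)
    (hπ : ∀ n, Function.Injective (π.f n)) (hε : π ≫ ε = ξ ≫ ε)
    (hΔ : ∀ n (z : P.X n), ∃ t : (P ⊗ P).X n,
      ((π ⊗ₘ π).f n).hom t = comulAt B n ((π.f n).hom z) ∧
      ((ξ ⊗ₘ ξ).f n).hom t = comulAt X n ((ξ.f n).hom z)) :
    ∃ (G : DGcoAlg K) (π' : G ⟶ B) (ξ' : G ⟶ X), (∀ n, Function.Injective (mapAt π' n)) ∧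
      ∀ n b x, (∃ g, mapAt π' n g = b ∧ mapAt ξ' n g = x) ↔
        ∃ z, (π.f n).hom z = b ∧ (ξ.f n).hom z = x := by
  have : Mono π := mono_of_injective _ hπ
  obtain ⟨δ, hδ⟩ := exists_lift (π ⊗ₘ π) (π ≫ Δ) (fun n z => by
    obtain ⟨t, ht, -⟩ := hΔ n z
    exact ⟨t, ht⟩)
  let : ComonObj P := ComonObj.ofMono π δ hδ
  have hπ' : IsComonHom π := ⟨rfl, hδ.symm⟩
  suffices h : ξ ≫ Δ = δ ≫ (ξ ⊗ₘ ξ) from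
    
    have hξ' : IsComonHom ξ := ⟨hε.symm, h⟩
    ⟨Comon.mk P, Comon.Hom.mk π, Comon.Hom.mk ξ, hπ, fun n b x => Iff.rfl⟩
  ext n z
  obtain ⟨t, ht, ht'⟩ := hΔ n z
  -- Injectivity of `π ⊗ π` forces the lift `t` to be the comultiplication of `z`, so the condition
  -- on `ξ` concerns that same tensor.
  have : t = (δ.f n).hom z := by
    apply injective_of_mono (π ⊗ₘ π) n
    exact ht.trans congr(($(hδ).f n).hom z).symm
  subst this
  exact ht'.symm

/-- A graded subspace closed under the differential underlies a subcomplex. -/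
lemma _root_.DGVct.exists_subcomplex {B : DGVct K} (S : ∀ n, Submodule K (B.X n))
    (hd : ∀ m n, ∀ x ∈ S m, (B.d m n).hom x ∈ S n) :
    ∃ (P : DGVct K) (π : P ⟶ B), (∀ n, Function.Injective (π.f n)) ∧
      ∀ n, LinearMap.range (π.f n).hom = S n :=
  ⟨{  X := fun n => ModuleCat.of K (S n)
      d := fun m n => ModuleCat.ofHom ((B.d m n).hom.restrict (hd m n))
      shape := fun m n h => by
        ext x
        simp [B.shape m n h]
      d_comp_d' := fun i j k _ _ => by
        ext x
        exact congr($(B.d_comp_d i j k).hom x.1) },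
    { f := fun n => ModuleCat.ofHom (S n).subtype }, fun n => (S n).injective_subtype,
    fun n => (S n).range_subtype⟩

/-- A graded subspace closed under the differential and the comultiplication underlies a
subcoalgebra. -/
lemma exists_subcoalgebra {B : DGcoAlg K} (S : ∀ n, Submodule K (B.X.X n))
    (hd : ∀ m n, ∀ x ∈ S m, (B.X.d m n).hom x ∈ S n) (hΔ : ∀ n, ∀ x ∈ S n, comulAt B n x ∈ sq S n) :
    ∃ (E : DGcoAlg K) (s : E ⟶ B), (∀ n, Function.Injective (mapAt s n)) ∧
      ∀ n, LinearMap.range (mapAt s n) = S n := by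
  obtain ⟨P, π, hπ, hS⟩ := exists_subcomplex S hd
  obtain ⟨E, s, _, hs, h⟩ := exists_of_lifts (B := B) (X := B) π π hπ rfl
    (fun n z => by
      have := hΔ n ((π.f n).hom z) (hS n ▸ LinearMap.mem_range_self (π.f n).hom z)
      rw [← funext hS, ← range_tensorHom] at this
      obtain ⟨t, ht⟩ := this
      exact ⟨t, ht, ht⟩)
  refine ⟨E, s, hs, fun n => ?_⟩
  rw [← hS]
  ext x
  refine ⟨?_, ?_⟩
  · rintro ⟨g, rfl⟩
    obtain ⟨z, hz, -⟩ := (h n _ _).1 ⟨g, rfl, rfl⟩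
    exact ⟨z, hz⟩
  · rintro ⟨z, rfl⟩
    obtain ⟨g, hg, -⟩ := (h n _ _).2 ⟨z, rfl, rfl⟩
    exact ⟨g, hg⟩

/-- Lifting through an injective morphism. -/
lemma exists_lift {A B C : DGcoAlg K} (j : A ⟶ B) (hj : ∀ n, Function.Injective (mapAt j n))
    (g : C ⟶ B) (h : ∀ n x, mapAt g n x ∈ LinearMap.range (mapAt j n)) :
    ∃ l : C ⟶ A, l ≫ j = g := by
  have : Mono j.hom := mono_of_injective _ hj
  obtain ⟨l, hl⟩ := DGVct.exists_lift j.hom g.hom h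
  suffices h : IsComonHom l from ⟨Comon.Hom.mk l, Comon.Hom.ext hl⟩
  constructor
  · rw [← IsComonHom.hom_counit j.hom, reassoc_of% hl, IsComonHom.hom_counit]
  · rw [← cancel_mono (j.hom ⊗ₘ j.hom), Category.assoc, Category.assoc,
      ← IsComonHom.hom_comul j.hom, reassoc_of% hl, IsComonHom.hom_comul,
      MonoidalCategory.tensorHom_comp_tensorHom, hl]

end DGcoAlg

/-! ### Countably spanned subspaces and closing off -/

/-- A subspace spanned by a countable set. -/
def Submodule.IsCountablySpanned {K M : Type*} [Field K] [AddCommGroup M] [Module K M]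
    (Z : Submodule K M) : Prop :=
  ∃ t : Set M, t.Countable ∧ Submodule.span K t = Z

namespace Submodule.IsCountablySpanned

variable {K M : Type*} [Field K] [AddCommGroup M] [Module K M]

/-- A countable spanning set does not restrict to a subspace, but the bound `ℵ₀` on the dimension
does; a basis of the smaller space is then countable. -/
lemma mono {Z Z' : Submodule K M} (h : Z'.IsCountablySpanned) (hZ : Z ≤ Z') :
    Z.IsCountablySpanned := by
  obtain ⟨t, ht, rfl⟩ := h
  have hr : Module.rank K Z ≤ Cardinal.aleph0 :=
    (Submodule.rank_mono hZ).trans ((rank_span_le t).trans ht.le_aleph0)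
  let b := Module.Free.chooseBasis K Z
  refine ⟨Set.range (fun i => (b i : M)), ?_, ?_⟩
  · have : Countable (Module.Free.ChooseBasisIndex K Z) := by
      rw [← Cardinal.mk_le_aleph0_iff, b.mk_eq_rank'']
      exact hr
    exact Set.countable_range _
  · have : Set.range (fun i => (b i : M)) = Z.subtype '' Set.range b := by
      rw [← Set.range_comp]; rfl
    rw [this, Submodule.span_image, b.span_eq, Submodule.map_top, Submodule.range_subtype]

lemma iSup {ι : Type*} [Countable ι] {Z : ι → Submodule K M}
    (h : ∀ i, (Z i).IsCountablySpanned) : (⨆ i, Z i).IsCountablySpanned := by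
  choose t ht hs using h
  exact ⟨⋃ i, t i, Set.countable_iUnion ht, by simp [Submodule.span_iUnion, hs]⟩

lemma sup {Z Z' : Submodule K M} (h : Z.IsCountablySpanned) (h' : Z'.IsCountablySpanned) :
    (Z ⊔ Z').IsCountablySpanned := by
  obtain ⟨t, ht, rfl⟩ := h
  obtain ⟨t', ht', rfl⟩ := h'
  exact ⟨t ∪ t', ht.union ht', Submodule.span_union _ _⟩

variable {M : ℕ → Type*} [∀ n, AddCommGroup (M n)] [∀ n, Module K (M n)]

lemma exists_mem {p : ℕ} (x : M p) : ∃ G : ∀ n, Submodule K (M n),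
    (∀ n, (G n).IsCountablySpanned) ∧ x ∈ G p := by
  refine ⟨fun n => Submodule.span K {y | ∃ h : p = n, h ▸ x = y}, fun n => ⟨_, ?_, rfl⟩, ?_⟩
  · refine Set.Subsingleton.countable ?_
    rintro _ ⟨h, rfl⟩ _ ⟨h', rfl⟩
    rfl
  · exact Submodule.subset_span ⟨rfl, rfl⟩

lemma exists_le {p : ℕ} {P : (∀ n, Submodule K (M n)) → Submodule K (M p)} (hP : Monotone P)
    {Z : Submodule K (M p)} (hZ : Z.IsCountablySpanned)
    (h : ∀ z ∈ Z, ∃ G : ∀ n, Submodule K (M n), (∀ n, (G n).IsCountablySpanned) ∧ z ∈ P G) :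
    ∃ G : ∀ n, Submodule K (M n), (∀ n, (G n).IsCountablySpanned) ∧ Z ≤ P G := by
  obtain ⟨t, ht, rfl⟩ := hZ
  have := ht.to_subtype
  choose G hG hG' using fun z : t => h z.1 (Submodule.subset_span z.2)
  refine ⟨⨆ z, G z, fun n => ?_, ?_⟩
  · rw [iSup_apply]
    exact iSup fun z => hG z n
  · rw [Submodule.span_le]
    intro z hz
    exact hP (le_iSup G ⟨z, hz⟩) (hG' ⟨z, hz⟩)

/-- Closing off a countably spanned graded subspace under countably many conditions. -/
lemma exists_closure {ι : Type*} [Countable ι] {p : ι → ℕ} (N : ∀ i, Submodule K (M (p i)))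
    (P : ∀ i, (∀ n, Submodule K (M n)) → Submodule K (M (p i))) (hP : ∀ i, Monotone (P i))
    (h : ∀ i, ∀ z ∈ N i, ∃ G : ∀ n, Submodule K (M n),
      (∀ n, (G n).IsCountablySpanned) ∧ z ∈ P i G)
    (G₀ : ∀ n, Submodule K (M n)) (hG₀ : ∀ n, (G₀ n).IsCountablySpanned) :
    ∃ G : ∀ n, Submodule K (M n), (∀ n, (G n).IsCountablySpanned) ∧ G₀ ≤ G ∧
      ∀ i, G (p i) ⊓ N i ≤ P i G := by
  have step (G : {G : ∀ n, Submodule K (M n) // ∀ n, (G n).IsCountablySpanned}) :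
      ∃ G' : {G : ∀ n, Submodule K (M n) // ∀ n, (G n).IsCountablySpanned}, G.1 ≤ G'.1 ∧
        ∀ i, G.1 (p i) ⊓ N i ≤ P i G'.1 := by
    choose H hH hH' using fun i => exists_le (hP i) ((G.2 (p i)).mono inf_le_left)
      (fun z (hz : z ∈ G.1 (p i) ⊓ N i) => h i z hz.2)
    refine ⟨⟨G.1 ⊔ ⨆ i, H i, fun n => (G.2 n).sup ?_⟩, le_sup_left, fun i => ?_⟩
    · rw [iSup_apply]
      exact iSup fun i => hH i n
    · exact (hH' i).trans (hP i ((le_iSup H i).trans le_sup_right))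
  choose S hS hS' using step
  let F (k : ℕ) := S^[k] ⟨G₀, hG₀⟩
  have hF (k) : F (k + 1) = S (F k) := Function.iterate_succ_apply' S k _
  have hmono : Monotone fun k => (F k).1 := monotone_nat_of_le_succ fun k => by
    simp only [hF]
    exact hS _
  refine ⟨⨆ k, (F k).1, fun n => ?_, le_iSup (fun k => (F k).1) 0, fun i => ?_⟩
  · rw [iSup_apply]
    exact iSup fun k => (F k).2 n
  -- The union of the stages is increasing, so `z` appears at a finite stage `k`, and its condition
  -- is met at stage `k + 1`.
  · rintro z ⟨hz, hz'⟩
    simp only [iSup_apply] at hz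
    rw [Submodule.coe_iSup_of_directed _ (Monotone.directed_le fun a b hab => hmono hab _)] at hz
    obtain ⟨k, hk⟩ := Set.mem_iUnion.1 hz
    have := hS' (F k) i ⟨hk, hz'⟩
    rw [← hF] at this
    exact hP i (le_iSup (fun k => (F k).1) (k + 1)) this

end Submodule.IsCountablySpanned

/-! ### Countable subextensions -/

namespace DGcoAlg

open DGVct Submodule

variable {K : Type u} [Field K]

/-- A tensor in `N ⊗ N` involves finitely many homogeneous factors from `N`. Keeping those factors
in `N` is what will make `G ∩ A` a subcoalgebra. -/
lemma _root_.DGVct.exists_countable_mem_sq {X : DGVct K} (N : ∀ n, Submodule K (X.X n)) (n : ℕ)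
    {z : (X ⊗ X).X n} (hz : z ∈ sq N n) : ∃ G : ∀ n, Submodule K (X.X n),
      (∀ n, (G n).IsCountablySpanned) ∧ z ∈ sq (G ⊓ N) n := by
  induction hz using Submodule.span_induction with
  | mem z hz =>
    obtain ⟨p, q, h, x, hx, y, hy, rfl⟩ := hz
    obtain ⟨G, hG, hxG⟩ := IsCountablySpanned.exists_mem (K := K) (M := fun n => X.X n) x
    obtain ⟨G', hG', hyG⟩ := IsCountablySpanned.exists_mem (K := K) (M := fun n => X.X n) y
    exact ⟨G ⊔ G', fun n => (hG n).sup (hG' n),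
      tmul_mem_sq h ⟨mem_sup_left hxG, hx⟩ ⟨mem_sup_right hyG, hy⟩⟩
  | zero => exact ⟨⊥, fun n => ⟨∅, by simp, by simp⟩, zero_mem _⟩
  | add x y _ _ hx hy =>
    obtain ⟨G, hG, hxG⟩ := hx
    obtain ⟨G', hG', hyG⟩ := hy
    refine ⟨G ⊔ G', fun n => (hG n).sup (hG' n), add_mem ?_ ?_⟩
    · exact sq_mono (fun n => inf_le_inf_right _ le_sup_left) n hxG
    · exact sq_mono (fun n => inf_le_inf_right _ le_sup_right) n hyG
  | smul a x _ hx =>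
    obtain ⟨G, hG, hxG⟩ := hx
    exact ⟨G, hG, smul_mem _ _ hxG⟩

variable (K) in
/-- The injective morphisms of differential graded coalgebras which are bijective in degree `0` and
have acyclic cokernel. -/
def acyclicExtensions : MorphismProperty (DGcoAlg K) := fun _ B j =>
  (∀ n, Function.Injective (mapAt j n)) ∧ Function.Surjective (mapAt j 0) ∧
    ∀ (n : ℕ) (b : B.X.X (n + 1)), (B.X.d (n + 1) n).hom b ∈ LinearMap.range (mapAt j n) →
      ∃ w : B.X.X (n + 2), b - (B.X.d (n + 2) (n + 1)).hom w ∈ LinearMap.range (mapAt j (n + 1))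

variable (K) in
/-- The acyclic extensions with target of countable dimension. -/
def countableAcyclicExtensions : MorphismProperty (DGcoAlg K) := fun _ B j =>
  acyclicExtensions K j ∧ ∀ n, (⊤ : Submodule K (B.X.X n)).IsCountablySpanned

/-- Given an acyclic extension `A ⟶ B`, each element of `B` lies in a subcoalgebra `E` of countable
dimension such that `A ∩ E ⟶ E` is an acyclic extension. -/
lemma exists_countable_subextension {A B : DGcoAlg K} (j : A ⟶ B) (hj : acyclicExtensions K j)
    {n₀ : ℕ} (b₀ : B.X.X n₀) :
    ∃ (F E : DGcoAlg K) (k : F ⟶ E) (u : F ⟶ A) (v : E ⟶ B), k ≫ v = u ≫ j ∧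
      countableAcyclicExtensions K k ∧ b₀ ∈ LinearMap.range (mapAt v n₀) ∧
      (∀ n, Function.Injective (mapAt v n)) ∧
      ∀ n a e, mapAt j n a = mapAt v n e → ∃ f, mapAt k n f = e ∧ mapAt u n f = a := by
  obtain ⟨hj₁, hj₂, hj₃⟩ := hj
  let 𝔄 (n) := LinearMap.range (mapAt j n)
  obtain ⟨G₀, hG₀, hb₀⟩ := IsCountablySpanned.exists_mem (K := K) (M := fun n => B.X.X n) b₀
  let GS := ∀ n, Submodule K (B.X.X n)
  -- Four countable families of closure conditions on `G`: it is stable under `Δ`; it is stable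
  -- under `d`; `Δ` of an element of `G ∩ A` lies in `(G ∩ A) ⊗ (G ∩ A)`; and an element of `G`
  -- whose boundary is in `A` is, modulo `A`, the boundary of an element of `G`. Imposing the third
  -- avoids computing `(G ⊗ G) ∩ (A ⊗ A)`.
  let N : ∀ i : (ℕ ⊕ ℕ × ℕ) ⊕ (ℕ ⊕ ℕ),
      Submodule K (B.X.X (Sum.elim (Sum.elim id Prod.fst) (Sum.elim id (· + 1)) i)) := fun
    | .inl (.inl n) => ⊤
    | .inl (.inr (m, n)) => ⊤
    | .inr (.inl n) => 𝔄 n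
    | .inr (.inr n) => (𝔄 n).comap (B.X.d (n + 1) n).hom
  let P : ∀ i : (ℕ ⊕ ℕ × ℕ) ⊕ (ℕ ⊕ ℕ), GS →
      Submodule K (B.X.X (Sum.elim (Sum.elim id Prod.fst) (Sum.elim id (· + 1)) i)) := fun
    | .inl (.inl n) => fun G => (sq G n).comap (comulAt B n)
    | .inl (.inr (m, n)) => fun G => (G n).comap (B.X.d m n).hom
    | .inr (.inl n) => fun G => (sq (G ⊓ 𝔄) n).comap (comulAt B n)
    | .inr (.inr n) => fun G => (G (n + 2)).map (B.X.d (n + 2) (n + 1)).hom ⊔ 𝔄 (n + 1)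
  have hP (i) : Monotone (P i) := by
    intro G G' hG
    match i with
    | .inl (.inl n) => exact comap_mono (sq_mono hG n)
    | .inl (.inr (m, n)) => exact comap_mono (hG n)
    | .inr (.inl n) => exact comap_mono (sq_mono (fun n => inf_le_inf_right _ (hG n)) n)
    | .inr (.inr n) => exact sup_le_sup_right (map_mono (hG _)) _
  obtain ⟨G, hG, hG₀G, hGP⟩ := IsCountablySpanned.exists_closure N P hP (by
    intro i z hz
    match i with
    | .inl (.inl n) =>
      obtain ⟨G, hG, h⟩ := exists_countable_mem_sq (fun _ => ⊤) n
        (show comulAt B n z ∈ sq (fun _ => ⊤) n by rw [sq_top]; trivial)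
      exact ⟨G, hG, sq_mono (fun _ => inf_le_left) n h⟩
    | .inl (.inr (m, n)) =>
      exact IsCountablySpanned.exists_mem (K := K) (M := fun n => B.X.X n) ((B.X.d m n).hom z)
    | .inr (.inl n) =>
      obtain ⟨a, rfl⟩ := hz
      exact exists_countable_mem_sq 𝔄 n (comulAt_mapAt_mem j n a)
    | .inr (.inr n) =>
      obtain ⟨w, hw⟩ := hj₃ n z hz
      obtain ⟨G, hG, h⟩ := IsCountablySpanned.exists_mem (K := K) (M := fun n => B.X.X n) w
      refine ⟨G, hG, ?_⟩
      rw [← add_sub_cancel ((B.X.d (n + 2) (n + 1)).hom w) z]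
      exact add_mem_sup (mem_map_of_mem h) hw) G₀ hG₀
  have hGd (m n x) (hx : x ∈ G m) : (B.X.d m n).hom x ∈ G n := hGP (.inl (.inr (m, n))) ⟨hx, trivial⟩
  obtain ⟨E, v, hv, hvG⟩ := exists_subcoalgebra G hGd (fun n x hx => hGP (.inl (.inl n)) ⟨hx, trivial⟩)
  obtain ⟨F, i, hi, hiG⟩ := exists_subcoalgebra (G ⊓ 𝔄)
    (fun m n x hx => ⟨hGd m n x hx.1, by
      obtain ⟨a, rfl⟩ := hx.2
      rw [← mapAt_d]
      exact ⟨_, rfl⟩⟩)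
    (fun n x hx => hGP (.inr (.inl n)) hx)
  obtain ⟨k, hk⟩ := exists_lift v hv i (fun n x => by
    rw [hvG]
    exact (hiG n ▸ LinearMap.mem_range_self (mapAt i n) x : mapAt i n x ∈ (G ⊓ 𝔄) n).1)
  obtain ⟨u, hu⟩ := exists_lift j hj₁ i (fun n x =>
    (hiG n ▸ LinearMap.mem_range_self (mapAt i n) x : mapAt i n x ∈ (G ⊓ 𝔄) n).2)
  have hvk (n x) : mapAt v n (mapAt k n x) = mapAt i n x := by rw [← mapAt_comp, hk]
  have hju (n x) : mapAt j n (mapAt u n x) = mapAt i n x := by rw [← mapAt_comp, hu]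
  have hvm (n x) : mapAt v n x ∈ G n := hvG n ▸ LinearMap.mem_range_self (mapAt v n) x
  -- Elementwise, `F` is the intersection of `A` and `E` inside `B`.
  have key (n a e) (h : mapAt j n a = mapAt v n e) : ∃ f, mapAt k n f = e ∧ mapAt u n f = a := by
    have : mapAt v n e ∈ (G ⊓ 𝔄) n := ⟨hvm n e, a, h⟩
    rw [← hiG] at this
    obtain ⟨f, hf⟩ := this
    refine ⟨f, hv n ?_, hj₁ n ?_⟩
    · rw [hvk, hf]
    · rw [hju, hf, h]
  refine ⟨F, E, k, u, v, hk.trans hu.symm, ⟨⟨fun n x y hxy => hi n ?_, fun e => ?_, ?_⟩, ?_⟩, ?_,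
    hv, key⟩
  · rw [← hvk, ← hvk, hxy]
  · obtain ⟨a, ha⟩ := hj₂ (mapAt v 0 e)
    obtain ⟨f, hf, -⟩ := key 0 a e ha
    exact ⟨f, hf⟩
  · rintro n b ⟨f, hf⟩
    have h1 : mapAt v (n + 1) b ∈ G (n + 1) ⊓ (𝔄 n).comap (B.X.d (n + 1) n).hom := by
      refine ⟨hvm _ _, ?_⟩
      change (B.X.d (n + 1) n).hom (mapAt v (n + 1) b) ∈ 𝔄 n
      rw [← mapAt_d, ← hf, hvk, ← hju]
      exact ⟨_, rfl⟩
    have h2 : mapAt v (n + 1) b ∈ (G (n + 2)).map (B.X.d (n + 2) (n + 1)).hom ⊔ 𝔄 (n + 1) :=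
      hGP (.inr (.inr n)) h1
    obtain ⟨_, ⟨w, hw, rfl⟩, y, ⟨a, rfl⟩, hz⟩ := mem_sup.1 h2
    rw [SetLike.mem_coe, ← hvG] at hw
    obtain ⟨w, rfl⟩ := hw
    obtain ⟨f, hf, -⟩ := key (n + 1) a (b - (E.X.d (n + 2) (n + 1)).hom w) (by
      rw [map_sub, mapAt_d, ← hz, add_sub_cancel_left])
    exact ⟨w, f, hf⟩
  · intro n
    obtain ⟨t, ht, hts⟩ := hG n
    refine ⟨mapAt v n ⁻¹' t, ht.preimage_of_injOn (hv n).injOn, ?_⟩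
    apply map_injective_of_injective (hv n)
    rw [map_span, Set.image_preimage_eq_of_subset, hts, Submodule.map_top, hvG]
    rw [← LinearMap.coe_range, hvG, ← hts]
    exact subset_span
  · rw [hvG]
    exact hG₀G n₀ hb₀

end DGcoAlg

/-! ### Partial lifts as graphs, and Zorn's lemma -/

namespace DGcoAlg

open DGVct Submodule

variable {K : Type u} [Field K]

section

variable {B X : DGVct K}

lemma _root_.DGVct.biprod_ext {n : ℕ} {z z' : (B ⊞ X).X n}
    (h₁ : ((biprod.fst : B ⊞ X ⟶ B).f n).hom z = ((biprod.fst : B ⊞ X ⟶ B).f n).hom z')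
    (h₂ : ((biprod.snd : B ⊞ X ⟶ X).f n).hom z = ((biprod.snd : B ⊞ X ⟶ X).f n).hom z') :
    z = z' := by
  have h (z : (B ⊞ X).X n) : ((biprod.inl : B ⟶ B ⊞ X).f n).hom
      (((biprod.fst : B ⊞ X ⟶ B).f n).hom z) + ((biprod.inr : X ⟶ B ⊞ X).f n).hom
      (((biprod.snd : B ⊞ X ⟶ X).f n).hom z) = z :=
    congr((($(biprod.total (X := B) (Y := X))).f n).hom z)
  rw [← h z, ← h z', h₁, h₂]

end

section

variable {A B X Y : DGcoAlg K}

/-- The first projection from the sum of the underlying complexes. -/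
noncomputable abbrev fstAt (B X : DGcoAlg K) (n : ℕ) : (B.X ⊞ X.X).X n →ₗ[K] B.X.X n :=
  ((biprod.fst : B.X ⊞ X.X ⟶ B.X).f n).hom

/-- The second projection from the sum of the underlying complexes. -/
noncomputable abbrev sndAt (B X : DGcoAlg K) (n : ℕ) : (B.X ⊞ X.X).X n →ₗ[K] X.X.X n :=
  ((biprod.snd : B.X ⊞ X.X ⟶ X.X).f n).hom

/-- The graph of a pair of morphisms. -/
noncomputable abbrev pairAt (j : A ⟶ B) (f : A ⟶ X) (n : ℕ) : A.X.X n →ₗ[K] (B.X ⊞ X.X).X n :=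
  ((biprod.lift j.hom f.hom).f n).hom

lemma fstAt_pairAt (j : A ⟶ B) (f : A ⟶ X) (n : ℕ) (a : A.X.X n) :
    fstAt B X n (pairAt j f n a) = mapAt j n a :=
  congr((($(biprod.lift_fst j.hom f.hom)).f n).hom a)

lemma sndAt_pairAt (j : A ⟶ B) (f : A ⟶ X) (n : ℕ) (a : A.X.X n) :
    sndAt B X n (pairAt j f n a) = mapAt f n a :=
  congr((($(biprod.lift_snd j.hom f.hom)).f n).hom a)

/-- A graded subspace `Γ` of `B ⊕ X` is comultiplicative if the pairs `(Δ b, Δ x)`, for `(b, x)` in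
`Γ`, come from `Γ ⊗ Γ`. -/
def IsComultiplicative (B X : DGcoAlg K) (Γ : ∀ n, Submodule K ((B.X ⊞ X.X).X n)) : Prop :=
  ∀ n, ∀ z ∈ Γ n, ∃ t ∈ sq Γ n,
    ((biprod.fst (X := B.X) (Y := X.X) ⊗ₘ biprod.fst).f n).hom t = comulAt B n (fstAt B X n z) ∧
    ((biprod.snd (X := B.X) (Y := X.X) ⊗ₘ biprod.snd).f n).hom t = comulAt X n (sndAt B X n z)

lemma tensor_map_map {P Q R : DGVct K} (f : P ⟶ Q) (g : Q ⟶ R) (n : ℕ) (t : (P ⊗ P).X n) :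
    ((g ⊗ₘ g).f n).hom (((f ⊗ₘ f).f n).hom t) = (((f ≫ g) ⊗ₘ (f ≫ g)).f n).hom t := by
  rw [← MonoidalCategory.tensorHom_comp_tensorHom]
  rfl

lemma isComultiplicative_range_pairAt (j : A ⟶ B) (f : A ⟶ X) :
    IsComultiplicative B X (fun n => LinearMap.range (pairAt j f n)) := by
  rintro n _ ⟨a, rfl⟩
  let l := biprod.lift j.hom f.hom
  refine ⟨((l ⊗ₘ l).f n).hom (comulAt A n a), ?_, ?_, ?_⟩
  · rw [← range_tensorHom]
    exact ⟨_, rfl⟩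
  · rw [tensor_map_map, biprod.lift_fst, fstAt_pairAt, comulAt_mapAt]
  · rw [tensor_map_map, biprod.lift_snd, sndAt_pairAt, comulAt_mapAt]

/-- The condition is linear in `z` and monotone in `Γ`, so it passes to arbitrary sums. This is the
advantage of graphs: adding two partial lifts needs no pushout of coalgebras. -/
lemma IsComultiplicative.iSup {ι : Type*} {Γ : ι → ∀ n, Submodule K ((B.X ⊞ X.X).X n)}
    (h : ∀ i, IsComultiplicative B X (Γ i)) : IsComultiplicative B X (⨆ i, Γ i) := by
  intro n z hz
  rw [iSup_apply] at hz
  induction hz using Submodule.iSup_induction' with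
  | mem i z hz =>
    obtain ⟨t, ht, h₁, h₂⟩ := h i n z hz
    exact ⟨t, sq_mono (le_iSup Γ i) n ht, h₁, h₂⟩
  | zero => exact ⟨0, zero_mem _, by simp, by simp⟩
  | add x y _ _ hx hy =>
    obtain ⟨t, ht, h₁, h₂⟩ := hx
    obtain ⟨t', ht', h₁', h₂'⟩ := hy
    exact ⟨t + t', add_mem ht ht', by simp only [map_add, h₁, h₁'], by simp only [map_add, h₂, h₂']⟩

/-- The graph of a lift, defined on a subcoalgebra of `B`, in the square given by `j : A ⟶ B`,
`f : A ⟶ X`, `g : B ⟶ Y` and `p : X ⟶ Y`; moreover the subcoalgebra is required to have acyclic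
quotient. -/
structure IsPartialLift (j : A ⟶ B) (f : A ⟶ X) (g : B ⟶ Y) (p : X ⟶ Y)
    (Γ : ∀ n, Submodule K ((B.X ⊞ X.X).X n)) : Prop where
  pair_mem : ∀ n a, pairAt j f n a ∈ Γ n
  d_mem : ∀ m n, ∀ z ∈ Γ m, ((B.X ⊞ X.X).d m n).hom z ∈ Γ n
  comul : IsComultiplicative B X Γ
  eq_zero : ∀ n, ∀ z ∈ Γ n, fstAt B X n z = 0 → z = 0
  map_eq : ∀ n, ∀ z ∈ Γ n, mapAt p n (sndAt B X n z) = mapAt g n (fstAt B X n z)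
  acyclic : ∀ (n : ℕ) (b : B.X.X (n + 1)), ∀ z ∈ Γ n, fstAt B X n z = (B.X.d (n + 1) n).hom b →
    ∃ (w : B.X.X (n + 2)), ∃ z' ∈ Γ (n + 1),
      fstAt B X (n + 1) z' = b - (B.X.d (n + 2) (n + 1)).hom w

lemma mapAt_counit (p : X ⟶ Y) (n : ℕ) (x : X.X.X n) :
    ((ε[Y.X] : Y.X ⟶ _).f n).hom (mapAt p n x) = ((ε[X.X] : X.X ⟶ _).f n).hom x := by
  have : p.hom ≫ ε = ε := IsComonHom.hom_counit _
  exact congr((($this).f n).hom x)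

/-- The projection to `B` is injective on `Γ`, so `Γ` is the graph of a map on a subcoalgebra of
`B`; comultiplicativity makes that map a coalgebra morphism. -/
lemma IsPartialLift.exists_coalgebra {j : A ⟶ B} {f : A ⟶ X} {g : B ⟶ Y} {p : X ⟶ Y}
    {Γ : ∀ n, Submodule K ((B.X ⊞ X.X).X n)} (h : IsPartialLift j f g p Γ) :
    ∃ (G : DGcoAlg K) (π : G ⟶ B) (ξ : G ⟶ X), (∀ n, Function.Injective (mapAt π n)) ∧
      ∀ n b x, (∃ y, mapAt π n y = b ∧ mapAt ξ n y = x) ↔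
        ∃ z ∈ Γ n, fstAt B X n z = b ∧ sndAt B X n z = x := by
  obtain ⟨Q, i, hi, hiΓ⟩ := exists_subcomplex Γ h.d_mem
  have hmem (n z) : (i.f n).hom z ∈ Γ n := hiΓ n ▸ LinearMap.mem_range_self (i.f n).hom z
  have hinj (n) : Function.Injective ((i ≫ biprod.fst (X := B.X) (Y := X.X)).f n) := by
    refine (injective_iff_map_eq_zero ((i ≫ biprod.fst).f n).hom).2 fun z hz => ?_
    exact (injective_iff_map_eq_zero (i.f n).hom).1 (hi n) z (h.eq_zero n _ (hmem n z) hz)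
  obtain ⟨G, π, ξ, hπ, H⟩ := exists_of_lifts (B := B) (X := X) (i ≫ biprod.fst) (i ≫ biprod.snd)
    hinj (by
      -- Compatibility with counits is automatic: `p` and `g` preserve counits, and the two
      -- components of `z` have the same image in `Y`.
      ext n z
      have := h.map_eq n _ (hmem n z)
      have h2 := mapAt_counit p n (sndAt B X n ((i.f n).hom z))
      rw [this, mapAt_counit] at h2
      exact h2) (fun n z => by
      obtain ⟨t, ht, h₁, h₂⟩ := h.comul n _ (hmem n z)
      rw [← funext hiΓ, ← range_tensorHom] at ht
      obtain ⟨t, rfl⟩ := ht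
      rw [tensor_map_map] at h₁ h₂
      exact ⟨t, h₁, h₂⟩)
  refine ⟨G, π, ξ, hπ, fun n b x => (H n b x).trans ⟨?_, ?_⟩⟩
  · rintro ⟨z, h₁, h₂⟩
    exact ⟨_, hmem n z, h₁, h₂⟩
  · rintro ⟨z, hz, h₁, h₂⟩
    rw [← hiΓ] at hz
    obtain ⟨z, rfl⟩ := hz
    exact ⟨z, h₁, h₂⟩

lemma fstAt_d (m n : ℕ) (z : (B.X ⊞ X.X).X m) :
    fstAt B X n (((B.X ⊞ X.X).d m n).hom z) = (B.X.d m n).hom (fstAt B X m z) :=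
  congr($((biprod.fst : B.X ⊞ X.X ⟶ B.X).comm m n).hom z).symm

lemma pairAt_d (j : A ⟶ B) (f : A ⟶ X) (m n : ℕ) (z : A.X.X m) :
    pairAt j f n ((A.X.d m n).hom z) = ((B.X ⊞ X.X).d m n).hom (pairAt j f m z) :=
  congr($((biprod.lift j.hom f.hom).comm m n).hom z).symm

lemma isPartialLift_range {j : A ⟶ B} (hj : acyclicExtensions K j) {f : A ⟶ X} {g : B ⟶ Y}
    {p : X ⟶ Y} (h : f ≫ p = j ≫ g) :
    IsPartialLift j f g p (fun n => LinearMap.range (pairAt j f n)) where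
  pair_mem n a := ⟨a, rfl⟩
  d_mem := by
    rintro m n _ ⟨a, rfl⟩
    rw [← pairAt_d]
    exact ⟨_, rfl⟩
  comul := isComultiplicative_range_pairAt j f
  eq_zero := by
    rintro n _ ⟨a, rfl⟩ ha
    rw [fstAt_pairAt] at ha
    rw [(injective_iff_map_eq_zero (mapAt j n)).1 (hj.1 n) a ha, map_zero]
  map_eq := by
    rintro n _ ⟨a, rfl⟩
    rw [fstAt_pairAt, sndAt_pairAt, ← mapAt_comp, ← mapAt_comp, h]
  acyclic := by
    rintro n b _ ⟨a, rfl⟩ ha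
    rw [fstAt_pairAt] at ha
    obtain ⟨w, a, hw⟩ := hj.2.2 n b ⟨a, ha⟩
    exact ⟨w, _, ⟨a, rfl⟩, (fstAt_pairAt _ _ _ _).trans hw⟩

lemma IsPartialLift.iSup {j : A ⟶ B} {f : A ⟶ X} {g : B ⟶ Y} {p : X ⟶ Y} {ι : Type*} [Nonempty ι]
    {Γ : ι → ∀ n, Submodule K ((B.X ⊞ X.X).X n)} (h : ∀ i, IsPartialLift j f g p (Γ i))
    (hΓ : Directed (· ≤ ·) Γ) : IsPartialLift j f g p (⨆ i, Γ i) := by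
  have hmem (n z) : z ∈ (⨆ i, Γ i) n ↔ ∃ i, z ∈ Γ i n := by
    rw [iSup_apply]
    exact Submodule.mem_iSup_of_directed _ (fun i k => (hΓ i k).imp fun l hl => ⟨hl.1 n, hl.2 n⟩)
  constructor
  · intro n a
    exact (hmem _ _).2 ⟨Classical.arbitrary ι, (h _).pair_mem n a⟩
  · intro m n z hz
    obtain ⟨i, hi⟩ := (hmem _ _).1 hz
    exact (hmem _ _).2 ⟨i, (h i).d_mem m n z hi⟩
  · exact .iSup fun i => (h i).comul
  · intro n z hz
    obtain ⟨i, hi⟩ := (hmem _ _).1 hz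
    exact (h i).eq_zero n z hi
  · intro n z hz
    obtain ⟨i, hi⟩ := (hmem _ _).1 hz
    exact (h i).map_eq n z hi
  · intro n b z hz hb
    obtain ⟨i, hi⟩ := (hmem _ _).1 hz
    obtain ⟨w, z', hz', hw⟩ := (h i).acyclic n b z hi hb
    exact ⟨w, z', (hmem _ _).2 ⟨i, hz'⟩, hw⟩

lemma IsPartialLift.acyclicExtensions {j : A ⟶ B} (hj : acyclicExtensions K j) {f : A ⟶ X}
    {g : B ⟶ Y} {p : X ⟶ Y} {Γ : ∀ n, Submodule K ((B.X ⊞ X.X).X n)} (h : IsPartialLift j f g p Γ)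
    {G : DGcoAlg K} {π : G ⟶ B} {ξ : G ⟶ X} (hπ : ∀ n, Function.Injective (mapAt π n))
    (H : ∀ n b x, (∃ y, mapAt π n y = b ∧ mapAt ξ n y = x) ↔
      ∃ z ∈ Γ n, fstAt B X n z = b ∧ sndAt B X n z = x) :
    acyclicExtensions K π := by
  refine ⟨hπ, fun b => ?_, ?_⟩
  · obtain ⟨a, rfl⟩ := hj.2.1 b
    obtain ⟨y, hy, -⟩ := (H 0 _ _).2 ⟨_, h.pair_mem 0 a, fstAt_pairAt j f 0 a, rfl⟩
    exact ⟨y, hy⟩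
  · rintro n b ⟨y, hy⟩
    obtain ⟨z, hz, hzb, -⟩ := (H n _ _).1 ⟨y, rfl, rfl⟩
    obtain ⟨w, z', hz', hw⟩ := h.acyclic n b z hz (hzb.trans hy)
    obtain ⟨y', hy', -⟩ := (H (n + 1) _ _).2 ⟨z', hz', hw, rfl⟩
    exact ⟨w, y', hy'⟩

/-- Extending a partial lift so that its domain contains a given element. -/
lemma IsPartialLift.exists_extension {j : A ⟶ B} (hj : DGcoAlg.acyclicExtensions K j) {f : A ⟶ X}
    {g : B ⟶ Y} {p : X ⟶ Y} (hp : (countableAcyclicExtensions K).rlp p)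
    {Γ : ∀ n, Submodule K ((B.X ⊞ X.X).X n)} (h : IsPartialLift j f g p Γ)
    {n₀ : ℕ} (b₀ : B.X.X n₀) :
    ∃ Γ', IsPartialLift j f g p Γ' ∧ Γ ≤ Γ' ∧ ∃ z ∈ Γ' n₀, fstAt B X n₀ z = b₀ := by
  obtain ⟨G, π, ξ, hπ, H⟩ := h.exists_coalgebra
  have hπξ : ξ ≫ p = π ≫ g := hom_ext_mapAt fun n y => by
    obtain ⟨z, hz, h₁, h₂⟩ := (H n _ _).1 ⟨y, rfl, rfl⟩
    rw [mapAt_comp, mapAt_comp, ← h₁, ← h₂, h.map_eq n z hz]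
  -- The subextension is taken of the domain `π` of the partial lift, not of `j`, so `F` is exactly
  -- the overlap on which the old and new lifts must agree.
  obtain ⟨F, E, k, u, v, hkv, hk, hb₀, hv, key⟩ :=
    exists_countable_subextension π (h.acyclicExtensions hj hπ H) b₀
  have := hp k hk
  have sq : CommSq (u ≫ ξ) k p (v ≫ g) := ⟨by rw [Category.assoc, hπξ, reassoc_of% hkv]⟩
  obtain ⟨e, hke, hep⟩ : ∃ e : E ⟶ X, k ≫ e = u ≫ ξ ∧ e ≫ p = v ≫ g :=
    ⟨sq.lift, sq.fac_left, sq.fac_right⟩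
  have hmem {n z} (hz : z ∈ (Γ ⊔ fun n => LinearMap.range (pairAt v e n)) n) :
      ∃ z₁ ∈ Γ n, ∃ y, z = z₁ + pairAt v e n y := by
    obtain ⟨z₁, hz₁, _, ⟨y, rfl⟩, rfl⟩ := mem_sup.1 hz
    exact ⟨z₁, hz₁, y, rfl⟩
  have hmem' {n z} (hz : z ∈ Γ n) (y) :
      z + pairAt v e n y ∈ (Γ ⊔ fun n => LinearMap.range (pairAt v e n)) n :=
    add_mem_sup hz ⟨y, rfl⟩
  refine ⟨Γ ⊔ fun n => LinearMap.range (pairAt v e n), ?_, le_sup_left, ?_⟩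
  · constructor
    · exact fun n a => mem_sup_left (h.pair_mem n a)
    · intro m n z hz₀
      obtain ⟨z, hz, y, rfl⟩ := hmem hz₀
      rw [map_add, ← pairAt_d]
      exact hmem' (h.d_mem m n z hz) _
    · rw [sup_eq_iSup]
      exact .iSup (Bool.rec (isComultiplicative_range_pairAt v e) h.comul)
    · intro n z hz₀ h0
      obtain ⟨z, hz, y, rfl⟩ := hmem hz₀
      rw [map_add, fstAt_pairAt] at h0
      obtain ⟨y', hy', hy''⟩ := (H n _ _).2 ⟨z, hz, rfl, rfl⟩
      -- If the two `B`-components cancel, they come from `F`, where `e` restricts to `ξ`; hence the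
      -- `X`-components cancel too.
      obtain ⟨x, hx, hx'⟩ := key n (-y') y (by
        rw [map_neg, hy']
        exact neg_eq_of_add_eq_zero_right h0)
      apply biprod_ext
      · rw [map_add, map_zero, fstAt_pairAt, h0]
      · rw [map_add, map_zero, sndAt_pairAt, ← hx, ← mapAt_comp, hke, mapAt_comp, hx', map_neg,
          hy'', add_neg_cancel]
    · intro n z hz₀
      obtain ⟨z, hz, y, rfl⟩ := hmem hz₀
      rw [map_add, map_add, map_add, map_add, h.map_eq n z hz, fstAt_pairAt, sndAt_pairAt,
        ← mapAt_comp, hep, mapAt_comp]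
    · intro n b z hz₀ hzb
      obtain ⟨z, hz, y, rfl⟩ := hmem hz₀
      rw [map_add, fstAt_pairAt] at hzb
      -- As `d (d b) = 0`, the boundary of `y` lies in the overlap `F`, so acyclicity of `E/F` moves
      -- `y` into `F` up to a boundary `d w`. In degree 0, `k` is surjective and no boundary is
      -- needed.
      obtain ⟨w, x, hwx⟩ : ∃ w x, y = (E.X.d (n + 1) n).hom w + mapAt k n x := by
        cases n with
        | zero =>
          obtain ⟨x, rfl⟩ := hk.1.2.1 y
          exact ⟨0, x, by simp⟩
        | succ m =>
          obtain ⟨y', hy', -⟩ := (H m _ _).2 ⟨_, h.d_mem _ m z hz, rfl, rfl⟩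
          rw [fstAt_d] at hy'
          obtain ⟨x, hx, -⟩ := key m (-y') ((E.X.d (m + 1) m).hom y) (by
            rw [map_neg, hy', mapAt_d]
            refine neg_eq_of_add_eq_zero_right ?_
            rw [← map_add, hzb]
            exact congr($(B.X.d_comp_d (m + 2) (m + 1) m).hom b))
          obtain ⟨w, x, hw⟩ := hk.1.2.2 m y ⟨x, hx⟩
          exact ⟨w, x, by rw [hw, add_sub_cancel]⟩
      obtain ⟨z', hz', hz'₁, -⟩ := (H n _ _).1 ⟨mapAt u n x, rfl, rfl⟩
      -- After subtracting `w` from `b`, the boundary lies in the old domain, whose quotient is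
      -- acyclic.
      obtain ⟨w', z'', hz'', hw'⟩ := h.acyclic n (b - mapAt v (n + 1) w) (z + z') (add_mem hz hz') (by
        rw [map_add, hz'₁, map_sub, ← hzb, hwx, map_add, mapAt_d, ← mapAt_comp, ← hkv, mapAt_comp]
        abel)
      refine ⟨w', _, hmem' hz'' w, ?_⟩
      rw [map_add, fstAt_pairAt, hw']
      abel
  · obtain ⟨y, rfl⟩ := hb₀
    exact ⟨pairAt v e n₀ y, mem_sup_right ⟨y, rfl⟩, fstAt_pairAt v e n₀ y⟩

end

variable (K) in
/-- The right lifting property against countable acyclic extensions implies the right lifting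
property against all acyclic extensions. -/
lemma rlp_countableAcyclicExtensions_le :
    (countableAcyclicExtensions K).rlp ≤ (acyclicExtensions K).rlp := by
  intro X Y p hp A B j hj
  refine ⟨fun {f g} sq => ?_⟩
  obtain ⟨Γ, -, hΓ⟩ := zorn_le_nonempty₀ {Γ | IsPartialLift j f g p Γ} (fun c hc hc' Γ₀ hΓ₀ => by
    have : Nonempty c := ⟨⟨Γ₀, hΓ₀⟩⟩
    exact ⟨⨆ Γ : c, Γ.1, .iSup (fun Γ => hc Γ.2) hc'.directed,
      fun Γ hΓ => le_iSup (fun Γ : c => Γ.1) ⟨Γ, hΓ⟩⟩) _ (isPartialLift_range hj sq.w)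
  have h : IsPartialLift j f g p Γ := hΓ.prop
  obtain ⟨G, π, ξ, hπ, H⟩ := h.exists_coalgebra
  -- By maximality an extension reaching `b` is no extension at all, so the domain is all of `B`.
  have hsurj (n b) : ∃ y, mapAt π n y = b := by
    obtain ⟨Γ', hΓ', hle, z, hz, hzb⟩ := h.exists_extension hj hp b
    obtain ⟨y, hy, -⟩ := (H n _ _).2 ⟨z, hΓ.le_of_ge hΓ' hle _ hz, hzb, rfl⟩
    exact ⟨y, hy⟩
  obtain ⟨s, hs⟩ := exists_lift π hπ (𝟙 B) (fun n b => hsurj n b)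
  have hπs (n b) : mapAt π n (mapAt s n b) = b := by rw [← mapAt_comp, hs]; rfl
  refine ⟨⟨s ≫ ξ, hom_ext_mapAt fun n a => ?_, hom_ext_mapAt fun n b => ?_⟩⟩
  · obtain ⟨y, hy, hy'⟩ := (H n _ _).2 ⟨_, h.pair_mem n a, fstAt_pairAt _ _ _ _, sndAt_pairAt _ _ _ _⟩
    rw [mapAt_comp, mapAt_comp, ← hy', ← hy]
    exact congrArg _ (hπ n (hπs n _))
  · obtain ⟨z, hz, h₁, h₂⟩ := (H n _ _).1 ⟨mapAt s n b, rfl, rfl⟩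
    rw [mapAt_comp, mapAt_comp, ← h₂, h.map_eq n z hz, h₁, hπs]

end DGcoAlg

/-! ### Relative cell complexes and left lifting properties -/

section

variable {C D : Type*} [Category* C] [Category* D]

/-- Relative cell complexes of morphisms sent to `T.llp` by a cocontinuous functor are sent to
`T.llp`. -/
lemma CategoryTheory.MorphismProperty.transfiniteCompositions_le_inverseImage_llp
    (F : C ⥤ D) [PreservesColimitsOfSize.{u, u} F] (T : MorphismProperty D)
    {I : MorphismProperty C} (hI : I ≤ T.llp.inverseImage F)
    (J : Type u) [LinearOrder J] [SuccOrder J] [OrderBot J] [WellFoundedLT J] :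
    (MorphismProperty.coproducts.{u} I).pushouts.transfiniteCompositionsOfShape J ≤
      T.llp.inverseImage F := by
  have h₁ : MorphismProperty.coproducts.{u} I ≤ T.llp.inverseImage F := by
    intro X Y f hf
    obtain ⟨J, ⟨X₁, X₂, c₁, c₂, h₁, h₂, φ, hφ⟩⟩ := (MorphismProperty.coproducts_iff _ _).1 hf
    apply (MorphismProperty.coproducts_le (W := T.llp))
    refine (MorphismProperty.coproducts_iff.{u} _ _).2 ⟨J, ?_⟩
    refine MorphismProperty.colimitsOfShape.mk' _ _ _ _ (isColimitOfPreserves F h₁)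
      (isColimitOfPreserves F h₂) (Functor.whiskerRight φ F) (fun j => hI _ (hφ j)) _ (fun j => ?_)
    change F.map _ ≫ F.map _ = F.map _ ≫ F.map _
    rw [← F.map_comp, ← F.map_comp, h₁.fac]
    rfl
  have h₂ : (MorphismProperty.coproducts.{u} I).pushouts ≤ T.llp.inverseImage F := by
    have := preservesColimitsOfSize_shrink.{0, u, 0, u} F
    rintro X Y f ⟨_, _, _, _, _, hg, h⟩
    exact MorphismProperty.of_isPushout (P := T.llp) (h.map F) (h₁ _ hg)
  have : PreservesWellOrderContinuousOfShape J F := ⟨fun _ _ => inferInstance⟩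
  intro X Y f ⟨hf⟩
  exact MorphismProperty.transfiniteCompositionsOfShape_le T.llp J _
    (MorphismProperty.transfiniteCompositionsOfShape_map_of_preserves J F f ⟨hf.ofLE h₂⟩)

end

/-! ### Colimits of comonoids -/

namespace CategoryTheory.Comon

variable (C : Type*) [Category* C] [MonoidalCategory C] (J : Type*) [Category* J]

/-- Dual to limits of monoids, which exist on underlying objects with no compatibility between the
tensor product and limits. -/
instance [HasColimitsOfShape J C] : HasColimitsOfShape J (Comon C) := by
  have : HasColimitsOfShape Jᵒᵖᵒᵖ C := hasColimitsOfShape_of_equivalence (opOpEquivalence J).symm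
  have : HasLimitsOfShape Jᵒᵖ Cᵒᵖ := hasLimitsOfShape_op_of_hasColimitsOfShape
  have : HasColimitsOfShape J (Mon Cᵒᵖ)ᵒᵖ := hasColimitsOfShape_op_of_hasLimitsOfShape
  exact Adjunction.hasColimitsOfShape_of_equivalence (Comon_EquivMon_OpOp C).functor

instance [HasColimitsOfShape J C] : PreservesColimitsOfShape J (Comon.forget C) := by
  have : HasColimitsOfShape Jᵒᵖᵒᵖ C := hasColimitsOfShape_of_equivalence (opOpEquivalence J).symm
  have : HasLimitsOfShape Jᵒᵖ Cᵒᵖ := hasLimitsOfShape_op_of_hasColimitsOfShape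
  have : PreservesColimitsOfShape J (Mon.forget Cᵒᵖ).op := preservesColimitsOfShape_op _ _
  exact inferInstanceAs (PreservesColimitsOfShape J
    ((Comon_EquivMon_OpOp C).functor ⋙ (Mon.forget Cᵒᵖ).op ⋙ (opOpEquivalence C).functor))

end CategoryTheory.Comon

/-! ### Acyclic extensions through lifting properties -/

lemma LinearMap.exists_comp_eq_of_ker_le {K V N W : Type*} [Field K] [AddCommGroup V] [Module K V]
    [AddCommGroup N] [Module K N] [AddCommGroup W] [Module K W] (f : V →ₗ[K] N) (φ : V →ₗ[K] W)
    (h : LinearMap.ker f ≤ LinearMap.ker φ) : ∃ ψ : N →ₗ[K] W, ψ ∘ₗ f = φ := by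
  obtain ⟨ψ, hψ⟩ := LinearMap.exists_extend
    ((LinearMap.ker f).liftQ φ h ∘ₗ f.quotKerEquivRange.symm.toLinearMap)
  refine ⟨ψ, LinearMap.ext fun v => ?_⟩
  have h₁ := congr($hψ ⟨f v, v, rfl⟩)
  have h₂ := f.quotKerEquivRange_symm_apply_image v ⟨v, rfl⟩
  exact h₁.trans (congrArg ((LinearMap.ker f).liftQ φ h) h₂)

/-- Functionals on `M` and `L` glue to a functional on `N`. -/
lemma LinearMap.exists_glue {K M L N W : Type*} [Field K] [AddCommGroup M] [Module K M]
    [AddCommGroup N] [Module K N] [AddCommGroup L] [Module K L] [AddCommGroup W] [Module K W]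
    (j : M →ₗ[K] N) (d : L →ₗ[K] N) (α : M →ₗ[K] W) (β : L →ₗ[K] W)
    (h : ∀ a b, j a = d b → α a = β b) :
    ∃ γ : N →ₗ[K] W, (∀ a, γ (j a) = α a) ∧ ∀ b, γ (d b) = β b := by
  obtain ⟨γ, hγ⟩ := LinearMap.exists_comp_eq_of_ker_le (j.coprod d) (α.coprod β) (by
    rintro ⟨a, b⟩ hab
    simp only [LinearMap.mem_ker, LinearMap.coprod_apply] at hab ⊢
    rw [h a (-b) (by rw [map_neg]; exact eq_neg_of_add_eq_zero_left hab), map_neg, neg_add_cancel])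
  exact ⟨γ, fun a => by simpa using congr($hγ (a, 0)), fun b => by simpa using congr($hγ (0, b))⟩

namespace DGVct

variable (K : Type u) [Field K]

/-- The acyclic complex with `K` in degrees `n + 1` and `n`. -/
noncomputable abbrev disk (n : ℕ) : DGVct K :=
  HomologicalComplex.double (𝟙 (ModuleCat.of K K))
    (show (ComplexShape.down ℕ).Rel (n + 1) n from rfl)

/-- The component of the disk in degree `n + 1`. -/
noncomputable abbrev diskTop (n : ℕ) : (disk K n).X (n + 1) ≅ ModuleCat.of K K :=
  HomologicalComplex.doubleXIso₀ _ _

/-- The component of the disk in degree `n`. -/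
noncomputable abbrev diskBot (n : ℕ) : (disk K n).X n ≅ ModuleCat.of K K :=
  HomologicalComplex.doubleXIso₁ _ _ (by simp)

lemma disk_d (n : ℕ) : (disk K n).d (n + 1) n ≫ (diskBot K n).hom = (diskTop K n).hom := by
  simp [HomologicalComplex.double_d _ _ (Nat.succ_ne_self n)]

/-- The projection from the disk to the sphere. -/
noncomputable def diskToSphere (n : ℕ) : disk K n ⟶
    (HomologicalComplex.single (ModuleCat.{u} K) (ComplexShape.down ℕ) (n + 1)).obj
      (ModuleCat.of K K) :=
  HomologicalComplex.mkHomToSingle (diskTop K n).hom (fun i hi => by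
    rw [HomologicalComplex.double_d_eq_zero₀ _ _ _ _ (by
      simp only [ComplexShape.down_Rel] at hi
      omega), zero_comp])

variable {K}

lemma hom_disk_f {A : DGVct K} {n : ℕ} (φ : A ⟶ disk K n) :
    φ.f (n + 1) ≫ (diskTop K n).hom = A.d (n + 1) n ≫ φ.f n ≫ (diskBot K n).hom := by
  rw [← disk_d, ← Category.assoc, ← Category.assoc, φ.comm]

/-- Maps into the disk correspond to functionals on degree `n`: the component in degree `n + 1` is
forced to be the functional composed with `d`. -/
lemma exists_hom_disk (A : DGVct K) (n : ℕ) (α : A.X n ⟶ ModuleCat.of K K) :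
    ∃ φ : A ⟶ disk K n, φ.f n ≫ (diskBot K n).hom = α := by
  refine ⟨{ f := fun k => if h : k = n + 1 then eqToHom (by rw [h]) ≫ A.d (n + 1) n ≫ α ≫
              (diskTop K n).inv ≫ eqToHom (by rw [h])
            else if h' : k = n then eqToHom (by rw [h']) ≫ α ≫ (diskBot K n).inv ≫
              eqToHom (by rw [h'])
            else 0
            comm' := ?_ }, ?_⟩
  · rintro i j hij
    obtain rfl : j + 1 = i := hij
    by_cases h : j = n
    · subst h
      simp [HomologicalComplex.double_d _ _ (Nat.succ_ne_self j)]
    · by_cases h' : j = n + 1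
      · subst h'
        simp [HomologicalComplex.double_d_eq_zero₀]
      · exact (HomologicalComplex.isZero_double_X _ _ j h' h).eq_of_tgt _ _
  · simp

end DGVct

namespace DGcoAlg

open DGVct

variable {K : Type u} [Field K]

/-- Morphisms with the left lifting property against all morphisms are isomorphisms. -/
lemma _root_.CategoryTheory.MorphismProperty.llp_top {C : Type*} [Category* C] :
    (⊤ : MorphismProperty C).llp = MorphismProperty.isomorphisms C := by
  ext A B i
  refine ⟨fun h => ?_, fun (h : IsIso i) => MorphismProperty.llp_of_isIso _ i⟩
  have := h i trivial
  have sq : CommSq (𝟙 A) i i (𝟙 B) := ⟨by simp⟩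
  exact ⟨sq.lift, sq.fac_left, sq.fac_right⟩

/-- The morphisms of vector spaces with zero target. -/
def _root_.ModuleCat.toZero (K : Type u) [Field K] : MorphismProperty (ModuleCat.{u} K) :=
  fun _ Y _ => IsZero Y

lemma _root_.ModuleCat.llp_toZero_iff {A B : ModuleCat.{u} K} (i : A ⟶ B) :
    (ModuleCat.toZero K).llp i ↔ Function.Injective i := by
  refine ⟨fun h => ?_, fun h X Y p (hp : IsZero Y) => ⟨fun {f g} sq => ?_⟩⟩
  · have := h (0 : A ⟶ ModuleCat.of K PUnit) (ModuleCat.isZero_of_subsingleton _)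
    have sq : CommSq (𝟙 A) i (0 : A ⟶ ModuleCat.of K PUnit) 0 := ⟨by simp⟩
    exact Function.LeftInverse.injective (g := sq.lift) fun x => congr($(sq.fac_left) x)
  · obtain ⟨r, hr⟩ := i.hom.exists_leftInverse_of_injective (LinearMap.ker_eq_bot.2 h)
    have hr' : i ≫ ModuleCat.ofHom r = 𝟙 _ := ModuleCat.hom_ext hr
    exact ⟨⟨ModuleCat.ofHom r ≫ f, by rw [reassoc_of% hr'], hp.eq_of_tgt _ _⟩⟩

/-- The morphism property consisting of the projection from a disk to a sphere. -/
def _root_.DGVct.diskProjection (K : Type u) [Field K] (n : ℕ) : MorphismProperty (DGVct K) :=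
  .ofHoms fun _ : Unit => diskToSphere K n

lemma _root_.DGVct.diskToSphere_f (n : ℕ) : (diskToSphere K n).f (n + 1) ≫
    (HomologicalComplex.singleObjXSelf (ComplexShape.down ℕ) (n + 1) (ModuleCat.of K K)).hom =
      (diskTop K n).hom := by
  simp [diskToSphere]

/-- A lifting problem is a functional `α` on `A_n` and a functional `β` on `B_{n+1}` with `β d = 0`
and `α d = β j`; a solution is `γ` on `B_n` with `γ j = α` and `γ d = β`. It exists once `α a = β b`
whenever `j a = d b`. There `b = d w + j a'` gives `a = d a'`, and both values equal `β (j a')`. -/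
lemma _root_.DGVct.diskProjection_llp {A B : DGVct K} (j : A ⟶ B)
    (hinj : ∀ n, Function.Injective (j.f n)) (n : ℕ)
    (h : ∀ b, (B.d (n + 1) n).hom b ∈ LinearMap.range (j.f n).hom →
      ∃ w, b - (B.d (n + 2) (n + 1)).hom w ∈ LinearMap.range (j.f (n + 1)).hom) :
    (diskProjection K n).llp j := by
  rintro _ _ _ ⟨⟩
  refine ⟨fun {φ ψ} sq => ?_⟩
  let σ := HomologicalComplex.singleObjXSelf (ComplexShape.down ℕ) (n + 1) (ModuleCat.of K K)
  let β := ψ.f (n + 1) ≫ σ.hom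
  have hβ : φ.f (n + 1) ≫ (diskTop K n).hom = j.f (n + 1) ≫ β := by
    have := congr($(sq.w).f (n + 1) ≫ σ.hom)
    rwa [HomologicalComplex.comp_f, HomologicalComplex.comp_f, Category.assoc, Category.assoc,
      diskToSphere_f] at this
  have hdβ : B.d (n + 2) (n + 1) ≫ β = 0 := by
    rw [← Category.assoc, ← ψ.comm, HomologicalComplex.single_obj_d, comp_zero, zero_comp]
  rw [hom_disk_f] at hβ
  obtain ⟨γ, hγ₁, hγ₂⟩ := LinearMap.exists_glue (j.f n).hom (B.d (n + 1) n).hom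
    (φ.f n ≫ (diskBot K n).hom).hom β.hom (fun a b hab => by
      obtain ⟨w, a', hw⟩ := h b ⟨a, hab⟩
      have h1 : a = (A.d (n + 1) n).hom a' := by
        apply hinj n
        refine hab.trans (Eq.trans ?_ congr($(j.comm (n + 1) n).hom a'))
        change _ = (B.d (n + 1) n).hom ((j.f (n + 1)).hom a')
        rw [hw, map_sub]
        exact ((sub_eq_self).2 congr($(B.d_comp_d (n + 2) (n + 1) n).hom w)).symm
      have h2 : β.hom b = β.hom ((j.f (n + 1)).hom a') := by
        rw [hw, map_sub]
        exact ((sub_eq_self).2 congr($(hdβ).hom w)).symm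
      rw [h1, h2]
      exact congr($(hβ).hom a'))
  obtain ⟨l, hl⟩ := exists_hom_disk B n (ModuleCat.ofHom γ)
  have hl₁ : j.f n ≫ l.f n = φ.f n := by
    rw [← cancel_mono (diskBot K n).hom, Category.assoc, hl]
    ext a
    exact hγ₁ a
  refine ⟨⟨l, ?_, ?_⟩⟩
  · apply HomologicalComplex.to_double_hom_ext
    · rw [← cancel_mono (diskTop K n).hom, hom_disk_f, HomologicalComplex.comp_f, Category.assoc,
        reassoc_of% hl₁, hom_disk_f]
    · exact hl₁
  · apply HomologicalComplex.to_single_hom_ext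
    rw [← cancel_mono σ.hom, HomologicalComplex.comp_f, Category.assoc, diskToSphere_f, hom_disk_f,
      hl]
    ext b
    exact hγ₂ b

/-- Otherwise some functional `β` kills boundaries and the image of `j` but not `b`. A lift would
give `γ` with `γ j = 0` and `γ d = β`, so `β b = γ (d b) = 0` since `d b` is in the image of `j`. -/
lemma _root_.DGVct.of_diskProjection_llp {A B : DGVct K} (j : A ⟶ B) (n : ℕ)
    (h : (diskProjection K n).llp j) (b : B.X (n + 1))
    (hb : (B.d (n + 1) n).hom b ∈ LinearMap.range (j.f n).hom) :
    ∃ w, b - (B.d (n + 2) (n + 1)).hom w ∈ LinearMap.range (j.f (n + 1)).hom := by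
  by_contra! hw
  have hb' : b ∉ LinearMap.range (B.d (n + 2) (n + 1)).hom ⊔ LinearMap.range (j.f (n + 1)).hom := by
    intro hb'
    obtain ⟨_, ⟨w, rfl⟩, y, hy, rfl⟩ := Submodule.mem_sup.1 hb'
    exact hw w (by simpa using hy)
  obtain ⟨β, hβ', hβ⟩ := Submodule.exists_le_ker_of_notMem hb'
  let σ := HomologicalComplex.singleObjXSelf (ComplexShape.down ℕ) (n + 1) (ModuleCat.of K K)
  let ψ : B ⟶ (HomologicalComplex.single (ModuleCat.{u} K) (ComplexShape.down ℕ) (n + 1)).obj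
      (ModuleCat.of K K) := HomologicalComplex.mkHomToSingle (ModuleCat.ofHom β) (fun i hi => by
    obtain rfl : n + 1 + 1 = i := hi
    ext w
    exact hβ (Submodule.mem_sup_left ⟨w, rfl⟩))
  have hψ : ψ.f (n + 1) ≫ σ.hom = ModuleCat.ofHom β := by
    simp [ψ, σ]
  have : HasLiftingProperty j (diskToSphere K n) := h (diskToSphere K n) ⟨⟨⟩⟩
  have sq : CommSq 0 j (diskToSphere K n) ψ := ⟨by
    apply HomologicalComplex.to_single_hom_ext
    rw [← cancel_mono σ.hom, HomologicalComplex.comp_f, Category.assoc, HomologicalComplex.comp_f,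
      Category.assoc, hψ, HomologicalComplex.zero_f, zero_comp]
    ext a
    exact (hβ (Submodule.mem_sup_right ⟨a, rfl⟩)).symm⟩
  obtain ⟨a, ha⟩ := hb
  have h1 : sq.lift.f (n + 1) ≫ (diskTop K n).hom = ModuleCat.ofHom β := by
    have := congr($(sq.fac_right).f (n + 1) ≫ σ.hom)
    rwa [HomologicalComplex.comp_f, Category.assoc, diskToSphere_f, hψ] at this
  have h2 : j.f n ≫ sq.lift.f n = 0 := congr($(sq.fac_left).f n)
  rw [hom_disk_f] at h1
  apply hβ'
  have h3 : (B.d (n + 1) n ≫ sq.lift.f n ≫ (diskBot K n).hom).hom b = β b := congr($(h1).hom b)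
  rw [← h3]
  have h4 : (sq.lift.f n).hom ((j.f n).hom a) = 0 := congr($(h2).hom a)
  change (diskBot K n).hom.hom ((sq.lift.f n).hom ((B.d (n + 1) n).hom b)) = 0
  rw [← ha, h4, map_zero]

/-- Each clause becomes a left lifting property after a cocontinuous functor to vector spaces or
complexes, and such classes are stable under the formation of cell complexes. -/
lemma acyclicExtensions_iff {A B : DGcoAlg K} (j : A ⟶ B) :
    acyclicExtensions K j ↔
      (∀ n, (ModuleCat.toZero K).llp.inverseImage
        (Comon.forget (DGVct K) ⋙ HomologicalComplex.eval _ _ n) j) ∧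
      (⊤ : MorphismProperty (ModuleCat.{u} K)).llp.inverseImage
        (Comon.forget (DGVct K) ⋙ HomologicalComplex.eval _ _ 0) j ∧
      ∀ n, (diskProjection K n).llp.inverseImage (Comon.forget (DGVct K)) j := by
  simp only [MorphismProperty.inverseImage_iff, ModuleCat.llp_toZero_iff,
    MorphismProperty.llp_top]
  refine and_congr_right fun hinj => and_congr ?_ (forall_congr' fun n =>
    ⟨fun h => diskProjection_llp j.hom hinj n h, fun h => of_diskProjection_llp j.hom n h⟩)
  rw [MorphismProperty.isomorphisms.iff, ConcreteCategory.isIso_iff_bijective]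
  exact ⟨fun h => ⟨hinj 0, h⟩, fun h => h.2⟩

instance : HasColimitsOfSize.{u, u} (DGcoAlg K) := ⟨fun _ _ => inferInstance⟩

instance : PreservesColimitsOfSize.{u, u} (Comon.forget (DGVct K)) := ⟨inferInstance⟩

instance (n : ℕ) : PreservesColimitsOfSize.{u, u} (Comon.forget (DGVct K) ⋙
    HomologicalComplex.eval (ModuleCat.{u} K) (ComplexShape.down ℕ) n) := by
  have : PreservesColimitsOfSize.{u, u}
      (HomologicalComplex.eval (ModuleCat.{u} K) (ComplexShape.down ℕ) n) := ⟨inferInstance⟩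
  exact comp_preservesColimits _ _

variable (K) in
/-- Relative cell complexes of acyclic extensions are acyclic extensions. -/
lemma transfiniteCompositions_le_acyclicExtensions {I : MorphismProperty (DGcoAlg K)}
    (hI : I ≤ acyclicExtensions K)
    (J : Type u) [LinearOrder J] [SuccOrder J] [OrderBot J] [WellFoundedLT J] :
    (MorphismProperty.coproducts.{u} I).pushouts.transfiniteCompositionsOfShape J ≤
      acyclicExtensions K := by
  intro X Y f hf
  have h {D : Type (u + 1)} [Category.{u} D] (F : DGcoAlg K ⥤ D) [PreservesColimitsOfSize.{u, u} F]
      (T : MorphismProperty D) (hT : acyclicExtensions K ≤ T.llp.inverseImage F) :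
      T.llp.inverseImage F f :=
    MorphismProperty.transfiniteCompositions_le_inverseImage_llp F T (hI.trans hT) J f hf
  exact (acyclicExtensions_iff f).2
    ⟨fun n => h _ _ fun _ _ j hj => ((acyclicExtensions_iff j).1 hj).1 n,
      h _ _ fun _ _ j hj => ((acyclicExtensions_iff j).1 hj).2.1,
      fun n => h _ _ fun _ _ j hj => ((acyclicExtensions_iff j).1 hj).2.2 n⟩

end DGcoAlg

/-! ### A set of countable generators -/

/-- Comonoids are determined up to isomorphism by their underlying objects up to a set of choices. -/
lemma CategoryTheory.Comon.essentiallySmall_of_map_forget {C : Type (u + 1)} [Category.{u} C]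
    [MonoidalCategory C] (P : ObjectProperty (Comon C))
    (h : ObjectProperty.EssentiallySmall.{u} (P.map (Comon.forget C))) :
    ObjectProperty.EssentiallySmall.{u} P := by
  refine .of_functor P (Comon.forget C) h fun Y => ?_
  have : Small.{u} (ComonObj Y) := small_of_injective
    (f := fun S : ComonObj Y => (S.counit, S.comul)) fun S S' h => by
      cases S; cases S'; cases h; rfl
  let f (S : ComonObj Y) : Comon C := let : ComonObj Y := S; Comon.mk Y
  refine ⟨.ofObj f, inferInstance, ?_⟩
  rintro B ⟨-, ⟨(e : B.X ≅ Y)⟩⟩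
  have hδ : (e.inv ≫ Δ[B.X] ≫ (e.hom ⊗ₘ e.hom)) ≫ (e.inv ⊗ₘ e.inv) = e.inv ≫ Δ := by
    simp [MonoidalCategory.tensorHom_comp_tensorHom]
  let S : ComonObj Y := .ofMono e.inv _ hδ
  refine ⟨f S, ⟨S⟩, ⟨Comon.mkIso e ?_ ?_⟩⟩
  · change e.hom ≫ e.inv ≫ ε[B.X] = _
    simp
  · change e.hom ≫ (e.inv ≫ Δ[B.X] ≫ (e.hom ⊗ₘ e.hom)) = _
    simp

/-- Complexes are determined up to isomorphism by their underlying graded objects up to a set of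
choices. -/
lemma HomologicalComplex.essentiallySmall_of_map_forget {V : Type (u + 1)} [Category.{u} V]
    [HasZeroMorphisms V] {ι : Type} (c : ComplexShape ι) (P : ObjectProperty (HomologicalComplex V c))
    (h : ObjectProperty.EssentiallySmall.{u} (P.map (HomologicalComplex.forget V c))) :
    ObjectProperty.EssentiallySmall.{u} P := by
  refine .of_functor P (HomologicalComplex.forget V c) h fun Y => ?_
  let T := {d : ∀ i j, Y i ⟶ Y j // (∀ i j, ¬ c.Rel i j → d i j = 0) ∧
    ∀ i j k, c.Rel i j → c.Rel j k → d i j ≫ d j k = 0}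
  let f (d : T) : HomologicalComplex V c := ⟨Y, d.1, d.2.1, d.2.2⟩
  refine ⟨.ofObj f, inferInstance, ?_⟩
  rintro B ⟨-, ⟨e⟩⟩
  let e' (i : ι) : B.X i ≅ Y i := ⟨e.hom i, e.inv i, congr_fun e.hom_inv_id i,
    congr_fun e.inv_hom_id i⟩
  let d : T := ⟨fun i j => (e' i).inv ≫ B.d i j ≫ (e' j).hom,
    fun i j hij => by simp [B.shape i j hij], fun i j k _ _ => by simp⟩
  exact ⟨f d, ⟨d⟩, ⟨HomologicalComplex.Hom.isoOfComponents e' fun i j _ => by simp [f, d]⟩⟩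

namespace DGcoAlg

open DGVct

variable {K : Type u} [Field K]

variable (K) in
/-- The differential graded coalgebras of countable dimension. -/
def isCountable : ObjectProperty (DGcoAlg K) :=
  fun C => ∀ n, (⊤ : Submodule K (C.X.X n)).IsCountablySpanned

lemma _root_.Submodule.IsCountablySpanned.exists_equiv {M : Type*} [AddCommGroup M] [Module K M]
    (h : (⊤ : Submodule K M).IsCountablySpanned) :
    ∃ s : Submodule K (ULift.{u} ℕ →₀ K), Nonempty (M ≃ₗ[K] ((ULift.{u} ℕ →₀ K) ⧸ s)) := by
  obtain ⟨t, ht, hts⟩ := h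
  -- Adding `0` leaves the span unchanged and makes the set nonempty, so that a sequence enumerates
  -- it.
  obtain ⟨v, hv⟩ := (ht.insert 0).exists_eq_range (Set.insert_nonempty _ _)
  let l : (ULift.{u} ℕ →₀ K) →ₗ[K] M := Finsupp.linearCombination K (v ∘ ULift.down)
  have hl : Function.Surjective l := by
    rw [← LinearMap.range_eq_top, Finsupp.range_linearCombination,
      ULift.down_surjective.range_comp, ← hv, Submodule.span_insert_zero, hts]
  exact ⟨_, ⟨(l.quotKerEquivOfSurjective hl).symm⟩⟩

instance : ObjectProperty.EssentiallySmall.{u} (isCountable K) := by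
  apply Comon.essentiallySmall_of_map_forget
  apply HomologicalComplex.essentiallySmall_of_map_forget
  refine ⟨.ofObj fun (s : ℕ → Submodule K (ULift.{u} ℕ →₀ K)) n =>
    ModuleCat.of K ((ULift.{u} ℕ →₀ K) ⧸ s n), inferInstance, ?_⟩
  rintro X ⟨Y, ⟨C, hC, ⟨e₁⟩⟩, ⟨e₂⟩⟩
  choose s e using fun n => (hC n).exists_equiv
  refine ⟨_, ⟨s⟩, ⟨(((HomologicalComplex.forget _ _).mapIso e₁ ≪≫ e₂).symm ≪≫
    GradedObject.isoMk _ _ fun n => (e n).some.toModuleIso)⟩⟩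

instance : (acyclicExtensions K).RespectsIso := by
  refine MorphismProperty.RespectsIso.of_respects_arrow_iso _ fun f g e hf => ?_
  rw [acyclicExtensions_iff] at hf ⊢
  exact ⟨fun n => (MorphismProperty.arrow_mk_iso_iff _ e).1 (hf.1 n),
    (MorphismProperty.arrow_mk_iso_iff _ e).1 hf.2.1,
    fun n => (MorphismProperty.arrow_mk_iso_iff _ e).1 (hf.2.2 n)⟩

lemma countableAcyclicExtensions.isCountable_source {A B : DGcoAlg K} {k : A ⟶ B}
    (hk : countableAcyclicExtensions K k) : isCountable K A := fun n => by
  obtain ⟨t, ht, hts⟩ := (hk.2 n).mono (Z := LinearMap.range (mapAt k n)) le_top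
  obtain ⟨r, hr⟩ := (mapAt k n).exists_leftInverse_of_injective
    (LinearMap.ker_eq_bot.2 (hk.1.1 n))
  refine ⟨r '' t, ht.image _, ?_⟩
  rw [← Submodule.map_span, hts, ← LinearMap.range_comp, hr, LinearMap.range_id]

variable (K) in
-- Source and target of a countable acyclic extension are countable, so it is isomorphic to one
-- between chosen representatives, and these form a set.
lemma exists_isSmall_rlp_le : ∃ I : MorphismProperty (DGcoAlg K),
    MorphismProperty.IsSmall.{u} I ∧ I ≤ countableAcyclicExtensions K ∧
      I.rlp ≤ (acyclicExtensions K).rlp := by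
  obtain ⟨Q, _, hQ, hQ'⟩ := ObjectProperty.EssentiallySmall.exists_small_le.{u} (isCountable K)
  let ι := Σ (p : Subtype Q × Subtype Q), {k : p.1.1 ⟶ p.2.1 // countableAcyclicExtensions K k}
  let φ (i : ι) : i.1.1.1 ⟶ i.1.2.1 := i.2.1
  refine ⟨.ofHoms φ, inferInstance, ?_, fun X Y p hp =>
    rlp_countableAcyclicExtensions_le K p fun A B k hk => ?_⟩
  · rintro _ _ _ ⟨i⟩
    exact i.2.2
  · obtain ⟨A', hA', ⟨a⟩⟩ := hQ' A hk.isCountable_source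
    obtain ⟨B', hB', ⟨b⟩⟩ := hQ' B hk.2
    have e : Arrow.mk k ≅ Arrow.mk (a.inv ≫ k ≫ b.hom) := Arrow.isoMk a b (by simp)
    have : countableAcyclicExtensions K (a.inv ≫ k ≫ b.hom) :=
      ⟨(MorphismProperty.arrow_mk_iso_iff _ e).1 hk.1, hQ B' hB'⟩
    rw [HasLiftingProperty.iff_of_arrow_iso_left e p]
    exact hp _ (MorphismProperty.ofHoms.mk (f := φ) ⟨(⟨A', hA'⟩, ⟨B', hB'⟩), _, this⟩)

end DGcoAlg

/-! ### The small object argument at `ℵ₁` -/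

namespace DGcoAlg

open DGVct

variable {K : Type u} [Field K]

/-- Morphisms from a coalgebra of countable dimension to an `ℵ₁`-filtered colimit of subcoalgebras
factor through one of them. -/
lemma isCountable.exists_factorization {A : DGcoAlg K} (hA : isCountable K A)
    {J : Type u} [SmallCategory J] [Fact (Cardinal.aleph.{u} 1).IsRegular]
    [IsCardinalFiltered J (Cardinal.aleph.{u} 1)] {F : J ⥤ DGcoAlg K} {c : Cocone F}
    (hc : IsColimit c) (hinj : ∀ j n, Function.Injective (mapAt (c.ι.app j) n)) (g : A ⟶ c.pt) :
    ∃ (j : J) (l : A ⟶ F.obj j), l ≫ c.ι.app j = g := by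
  have := isFiltered_of_isCardinalFiltered J (Cardinal.aleph.{u} 1)
  have hex (n : ℕ) (x : A.X.X n) :
      ∃ j, mapAt g n x ∈ LinearMap.range (mapAt (c.ι.app j) n) := by
    obtain ⟨j, y, hy⟩ := Concrete.isColimit_exists_rep _ (isColimitOfPreserves
      (Comon.forget (DGVct K) ⋙
        HomologicalComplex.eval (ModuleCat.{u} K) (ComplexShape.down ℕ) n) hc) (mapAt g n x)
    exact ⟨j, y, hy⟩
  choose J₀ hJ₀ using hex
  choose t ht hts using hA
  have hcount (n : ℕ) : Countable (t n) := (ht n).to_subtype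
  -- The generators in all degrees together are countable, so one stage receives them all.
  have hlt : HasCardinalLT (Σ n, t n) (Cardinal.aleph.{u} 1) := by
    refine lt_of_le_of_lt (b := Cardinal.aleph0) ?_ ?_
    · exact Cardinal.lift_le_aleph0.2 Cardinal.mk_le_aleph0
    · simp
  let S (i : Σ n, t n) : J := J₀ i.1 i.2
  let j := IsCardinalFiltered.max S hlt
  refine ⟨j, exists_lift (c.ι.app j) (hinj j) g fun n x => ?_⟩
  have hle : (⊤ : Submodule K (A.X.X n)) ≤
      (LinearMap.range (mapAt (c.ι.app j) n)).comap (mapAt g n) := by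
    rw [← hts n, Submodule.span_le]
    intro x hx
    obtain ⟨y, hy⟩ := hJ₀ n x
    refine ⟨mapAt (F.map (IsCardinalFiltered.toMax S hlt ⟨n, x, hx⟩)) n y, ?_⟩
    rw [← hy, ← mapAt_comp, c.w]
  exact hle trivial

variable (K) in
lemma isCardinalForSmallObjectArgument [Fact (Cardinal.aleph.{u} 1).IsRegular]
    [OrderBot (Cardinal.aleph.{u} 1).ord.ToType] {I : MorphismProperty (DGcoAlg K)}
    [MorphismProperty.IsSmall.{u} I] (hI : I ≤ countableAcyclicExtensions K)
    (hI' : ∀ ⦃A B⦄ (i : A ⟶ B), I i → isCountable K A) :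
    I.IsCardinalForSmallObjectArgument (Cardinal.aleph.{u} 1) where
  hasPushouts := by
    have : HasColimitsOfSize.{0, 0} (DGcoAlg K) := hasColimitsOfSizeShrink.{0, 0, u, u} _
    infer_instance
  hasCoproducts := fun _ => inferInstance
  hasIterationOfShape := { hasColimitsOfShape := inferInstance }
  preservesColimit {A B X Y} i hi f hf := by
    have hfil := isFiltered_of_isCardinalFiltered (Cardinal.aleph.{u} 1).ord.ToType
      (Cardinal.aleph.{u} 1)
    -- The tail of a cell complex from stage `j` on is again a cell complex, hence an acyclic
    -- extension, hence injective.
    have hinj (j) (n) : Function.Injective (mapAt (hf.incl.app j) n) :=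
      (transfiniteCompositions_le_acyclicExtensions K (hI.trans fun _ _ _ h => h.1) _ _
        ⟨(hf.transfiniteCompositionOfShape' (I := I) fun s => s.i.2).ici j⟩).1 n
    refine preservesColimit_of_preserves_colimit_cocone hf.isColimit
      (Types.FilteredColimit.isColimitOf' _ _ (fun g => ?_) fun j x y hxy => ?_)
    · obtain ⟨j, l, hl⟩ := (hI' i hi).exists_factorization hf.isColimit hinj g
      exact ⟨j, l, hl.symm⟩
    · refine ⟨j, 𝟙 _, ?_⟩
      have : x = y := hom_ext_mapAt fun n a => hinj j n (by
        rw [← mapAt_comp, ← mapAt_comp]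
        exact congr(mapAt $hxy n a))
      rw [this]

variable (K) in
/-- Every morphism of differential graded coalgebras is an acyclic extension followed by a morphism
with the right lifting property with respect to the acyclic extensions. -/
lemma exists_factorization {C D : DGcoAlg K} (f : C ⟶ D) :
    ∃ (G : DGcoAlg K) (i : C ⟶ G) (p : G ⟶ D), acyclicExtensions K i ∧
      (acyclicExtensions K).rlp p ∧ i ≫ p = f := by
  obtain ⟨I, hI, hI', hIrlp⟩ := exists_isSmall_rlp_le K
  have : Fact (Cardinal.aleph.{u} 1).IsRegular := ⟨Cardinal.isRegular_aleph_one⟩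
  have : Nonempty (Cardinal.aleph.{u} 1).ord.ToType := by
    rw [Ordinal.nonempty_toType_iff, Cardinal.ord_aleph]
    exact (Ordinal.omega_pos 1).ne'
  let := WellFoundedLT.toOrderBot (Cardinal.aleph.{u} 1).ord.ToType
  have := isCardinalForSmallObjectArgument K hI' fun A B i hi => (hI' i hi).isCountable_source
  let κ := Cardinal.aleph.{u} 1
  exact ⟨_, SmallObject.ιObj I κ f, SmallObject.πObj I κ f,
    transfiniteCompositions_le_acyclicExtensions K (hI'.trans fun _ _ _ h => h.1) _ _
      (SmallObject.transfiniteCompositionsOfShape_ιObj I κ f),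
    hIrlp _ (SmallObject.rlp_πObj I κ f), SmallObject.ιObj_πObj I κ f⟩

end DGcoAlg

/-! ### Homology isomorphisms and connected coalgebras -/

section

variable {K : Type u} [Field K]

/-- Both directions are read off the long exact homology sequence. -/
lemma CategoryTheory.ShortComplex.ShortExact.isIso_homologyMap_iff {V : Type*} [Category* V]
    [Abelian V] {S : ShortComplex (ChainComplex V ℕ)} (hS : S.ShortExact) :
    (∀ n, IsIso (HomologicalComplex.homologyMap S.f n)) ↔ S.X₃.Acyclic := by
  refine ⟨fun h n => hS.exactAt_X₃ n, fun h n => ?_⟩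
  have hz (i : ℕ) : IsZero (S.X₃.homology i) := (h i).isZero_homology
  have : Epi (HomologicalComplex.homologyMap S.f n) :=
    (hS.homology_exact₂ n).epi_f ((hz n).eq_of_tgt _ _)
  have : Mono (HomologicalComplex.homologyMap S.f n) :=
    (hS.homology_exact₁ (n + 1) n rfl).mono_g ((hz (n + 1)).eq_of_src _ _)
  exact isIso_of_mono_of_epi _

/-- An injective morphism of complexes which is surjective in degree `0` is a quasi-isomorphism if and
only if its cokernel is acyclic. -/
lemma DGVct.isIso_homologyMap_iff {A B : DGVct K} (j : A ⟶ B)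
    (hj : ∀ n, Function.Injective (j.f n)) (hj₀ : Function.Surjective (j.f 0)) :
    (∀ n, IsIso (HomologicalComplex.homologyMap j n)) ↔
      ∀ (n : ℕ) (b : B.X (n + 1)), (B.d (n + 1) n).hom b ∈ LinearMap.range (j.f n).hom →
        ∃ w, b - (B.d (n + 2) (n + 1)).hom w ∈ LinearMap.range (j.f (n + 1)).hom := by
  have := mono_of_injective j hj
  let S : ShortComplex (DGVct K) := .mk j (cokernel.π j) (cokernel.condition j)
  have hS : S.ShortExact := { exact := ShortComplex.exact_cokernel j }
  have hS' (n : ℕ) := hS.map_of_exact (HomologicalComplex.eval _ _ n)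
  have hsurj (n : ℕ) : Function.Surjective (S.g.f n) := (hS' n).moduleCat_surjective_g
  have hmem (n : ℕ) (b : B.X n) : (S.g.f n).hom b = 0 ↔ b ∈ LinearMap.range (j.f n).hom := by
    have := (hS' n).exact.moduleCat_range_eq_ker
    exact (SetLike.ext_iff.1 this b).symm
  have hd (m n : ℕ) (b : B.X m) :
      (S.g.f n).hom ((B.d m n).hom b) = (S.X₃.d m n).hom ((S.g.f m).hom b) :=
    congr($(S.g.comm m n).hom b).symm
  have hexact (n : ℕ) : S.X₃.ExactAt (n + 1) ↔
      ∀ (b : B.X (n + 1)), (B.d (n + 1) n).hom b ∈ LinearMap.range (j.f n).hom →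
        ∃ w, b - (B.d (n + 2) (n + 1)).hom w ∈ LinearMap.range (j.f (n + 1)).hom := by
    rw [S.X₃.exactAt_iff' (n + 2) (n + 1) n (by simp) (by simp), ShortComplex.moduleCat_exact_iff]
    refine (hsurj (n + 1)).forall.trans (forall_congr' fun b => ?_)
    rw [← hmem, hd]
    refine imp_congr Iff.rfl ((hsurj (n + 2)).exists.trans (exists_congr fun w => ?_))
    rw [← hmem, map_sub, hd, sub_eq_zero, eq_comm]
    rfl
  rw [show (∀ n, IsIso (HomologicalComplex.homologyMap j n)) ↔ S.X₃.Acyclic from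
    hS.isIso_homologyMap_iff]
  refine ⟨fun h n => (hexact n).1 (h _), fun h n => ?_⟩
  cases n with
  | zero =>
    have h0 : IsZero (S.X₃.X 0) := by
      have : Subsingleton (S.X₃.X 0) := by
        refine subsingleton_of_forall_eq 0 fun z => ?_
        obtain ⟨b, rfl⟩ := hsurj 0 z
        exact (hmem 0 b).2 (hj₀ b)
      exact ModuleCat.isZero_of_subsingleton _
    rw [HomologicalComplex.exactAt_iff]
    exact ShortComplex.exact_of_isZero_X₂ _ h0
  | succ n => exact (hexact n).2 (h n)

namespace DGcoAlgConn

open DGcoAlg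

lemma acyclicCofibrations_iff {C D : DGcoAlgConn K} (f : C ⟶ D) :
    acyclicCofibrations K f ↔ acyclicExtensions K f.hom := by
  constructor
  · rintro ⟨h, h'⟩
    -- An injection between one-dimensional spaces is bijective; connectedness enters here.
    have h0 : Function.Surjective (mapAt f.hom 0) := by
      obtain ⟨eC⟩ := C.property
      obtain ⟨eD⟩ := D.property
      have := Module.Finite.equiv eC.symm
      have := Module.Finite.equiv eD.symm
      exact (LinearMap.injective_iff_surjective_of_finrank_eq_finrank
        (eC.trans eD.symm).finrank_eq).1 (h 0)
    exact ⟨h, h0, (DGVct.isIso_homologyMap_iff _ h h0).1 h'⟩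
  · rintro ⟨h, h0, h'⟩
    exact ⟨h, (DGVct.isIso_homologyMap_iff _ h h0).2 h'⟩

end DGcoAlgConn

end

theorem mainTheorem5 (K : Type u) [Field K] (C D : DGcoAlgConn K) (f : C ⟶ D) :
    ∃ (G : DGcoAlgConn K) (i : C ⟶ G) (p : G ⟶ D),
      DGcoAlgConn.acyclicCofibrations K i ∧ DGcoAlgConn.fibrations K p ∧ i ≫ p = f := by
  obtain ⟨G, i, p, hi, hp, hip⟩ := DGcoAlg.exists_factorization K f.hom
  obtain ⟨e⟩ := C.property
  -- Bijectivity of `i` in degree 0 transports connectedness from `C`; lifts found in all coalgebras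
  -- then belong to the full subcategory.
  have hG : DGcoAlg.isConnected K G :=
    ⟨(LinearEquiv.ofBijective (DGcoAlg.mapAt i 0) ⟨hi.1 0, hi.2.1⟩).symm.trans e⟩
  let ι := (DGcoAlg.isConnected K).ι
  refine ⟨⟨G, hG⟩, ObjectProperty.homMk i, ObjectProperty.homMk p,
    (DGcoAlgConn.acyclicCofibrations_iff _).2 hi, fun A B j hj => ⟨fun {u v} sq => ?_⟩,
    ι.map_injective hip⟩
  have := hp _ ((DGcoAlgConn.acyclicCofibrations_iff j).1 hj)
  have sq' : CommSq u.hom j.hom p v.hom := sq.map ι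
  exact ⟨⟨ObjectProperty.homMk sq'.lift, ι.map_injective sq'.fac_left,
    ι.map_injective sq'.fac_right⟩⟩
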